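/- All manifolds, metrics, maps and functions are smooth, and manifolds have no boundary. For a map $\varphi:(M^m,g)\to(N^n,h)$ between Riemannian manifolds, $\nabla^\varphi$ is the pull-back of the Levi-Civita connection of $h$ to $\varphi^{-1}TN$, $R^N(X,Y)Z=[\nabla^N_X,\nabla^N_Y]Z-\nabla^N_{[X,Y]}Z$, and $\tau(\varphi,g)=\mathrm{Trace}_g\nabla d\varphi$ is the tension field. For a vector field $X$ along $\varphi$, $$J^\varphi_g(X)=-\{\mathrm{Trace}_g(\nabla^\varphi\nabla^\varphi-\nabla^\varphi_{\nabla^M})X-\mathrm{Trace}_gR^N(d\varphi,X)d\varphi\},$$ where $\nabla^M$ is the Levi-Civita connection of $g$; the bitension field is $$\tau^2(\varphi,g)=\mathrm{Trace}_g(\nabla^\varphi\nabla^\varphi-\nabla^\varphi_{\nabla^M})\tau(\varphi,g)-\mathrm{Trace}_gR^N(d\varphi,\tau(\varphi,g))d\varphi=-J^\varphi_g(\tau(\varphi,g)),$$ and $\varphi:(M,g)\to(N,h)$ is biharmonic if $\tau^2(\varphi,g)$ vanishes identically. **Proposition.** Let $\varphi:(M^m,g)\to(N^n,h)$ be a conformal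 immersion with $\varphi^*h=\lambda^2g$, where $\lambda>0$. Let $\bar g=\varphi^*h=\lambda^2g$, and let $\eta=\frac1m\mathrm{Trace}_{\bar g}B$ be the mean curvature vector of the associated isometric immersion $\varphi:(M^m,\bar g)\to(N^n,h)$, where $B$ is its second fundamental form, i.e. $B(X,Y)$ is the normal component of $\nabla^\varphi_X(d\varphi(Y))$. Then $\varphi:(M^m,g)\to(N^n,h)$ is biharmonic if and only if, everywhere on $M$, $$\lambda^4\tau^2(\varphi,\bar g)=-(m-2)J^\varphi_g(d\varphi(\mathrm{grad}\ln\lambda))+2m\lambda^2\left(-\Delta\ln\lambda-2|\mathrm{grad}\ln\lambda|^2\right)\eta+m(m-6)\lambda^2\nabla^\varphi_{\mathrm{grad}\ln\lambda}\eta,$$ where $\mathrm{grad}$, $|\cdot|$ and $\Delta f=\mathrm{Trace}_g\nabla df$ are taken with respect to $g$. -/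

import Mathlib

open scoped Manifold ContDiff

noncomputable section

namespace RiemannianMaps

/-! ### Linear algebra of an inner product on `ℝᵐ` -/

/-- The model space `ℝᵐ`. -/
abbrev Euc (m : ℕ) : Type := EuclideanSpace ℝ (Fin m)

/-- Bilinear forms on `ℝᵐ`. -/
abbrev Bil (m : ℕ) : Type := Euc m →L[ℝ] Euc m →L[ℝ] ℝ

/-- The standard basis vector `e_i` of `ℝᵐ`. -/
def stdVec {m : ℕ} (i : Fin m) : Euc m := EuclideanSpace.single i 1

/-- The matrix `(G_{ij})` of a bilinear form. -/
def gram {m : ℕ} (G : Bil m) : Matrix (Fin m) (Fin m) ℝ :=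
  Matrix.of fun i j => G (stdVec i) (stdVec j)

/-- Raising an index: `ℓ^♯ = ∑ G^{ij} ℓ(e_j) e_i`, i.e. the vector with `G(ℓ^♯, z) = ℓ(z)` when `G`
is an inner product and `ℓ` is linear. -/
def sharp {m : ℕ} (G : Bil m) (ℓ : Euc m → ℝ) : Euc m :=
  ∑ i, ∑ j, ((gram G)⁻¹ i j * ℓ (stdVec j)) • stdVec i

/-- The `G`-trace `∑ G^{ij} B(e_i, e_j)` of a vector-valued bilinear form `B`. -/
def metricTrace {m n : ℕ} (G : Bil m) (B : Euc m → Euc m → Euc n) : Euc n :=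
  ∑ i, ∑ j, (gram G)⁻¹ i j • B (stdVec i) (stdVec j)

/-- The `G`-trace `∑ G^{ij} B(e_i, e_j)` of a real-valued bilinear form `B`. -/
def scalarTrace {m : ℕ} (G : Bil m) (B : Euc m → Euc m → ℝ) : ℝ :=
  ∑ i, ∑ j, (gram G)⁻¹ i j * B (stdVec i) (stdVec j)

/-! ### Riemannian geometry in a coordinate domain

`G : Euc m → Bil m` is the coordinate expression of a metric near a point `u`. Constant vectors stand
for vector fields with constant coordinates. -/

/-- Christoffel symbols of the first kind,
`½ (∂_v G(w, z) + ∂_w G(v, z) - ∂_z G(v, w))`. -/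
def christoffelFirst {m : ℕ} (G : Euc m → Bil m) (u v w z : Euc m) : ℝ :=
  (1 / 2) * (fderiv ℝ G u v w z + fderiv ℝ G u w v z - fderiv ℝ G u z v w)

/-- Christoffel symbols of the Levi-Civita connection, as the vector
`Γ_u(v, w) = ∑ Γ^k_{ij} v^i w^j e_k`. -/
def christoffel {m : ℕ} (G : Euc m → Bil m) (u v w : Euc m) : Euc m :=
  sharp (G u) (christoffelFirst G u v w)

/-- The curvature operator `R(v, w) z = ∇_v ∇_w z - ∇_w ∇_v z - ∇_{[v, w]} z`
(the coordinate fields commute). -/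
def coordCurvature {m : ℕ} (G : Euc m → Bil m) (u v w z : Euc m) : Euc m :=
  fderiv ℝ (fun y => christoffel G y w z) u v - fderiv ℝ (fun y => christoffel G y v z) u w
    + christoffel G u v (christoffel G u w z) - christoffel G u w (christoffel G u v z)

/-- The pull-back connection: for a map `f` into a domain with metric `H` and a field `Y` along `f`,
`(∇^f_v Y)(u) = ∂_v Y(u) + Γ^H_{f(u)}(df(v), Y(u))`. -/
def coordCovDeriv {m n : ℕ} (H : Euc n → Bil n) (f Y : Euc m → Euc n) (v u : Euc m) : Euc n :=
  fderiv ℝ Y u v + christoffel H (f u) (fderiv ℝ f u v) (Y u)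

/-- The second covariant derivative `∇^f_v ∇^f_w Y - ∇^f_{∇_v w} Y` of a field `Y` along `f`. -/
def coordSecondCovDeriv {m n : ℕ} (G : Euc m → Bil m) (H : Euc n → Bil n) (f Y : Euc m → Euc n)
    (u v w : Euc m) : Euc n :=
  coordCovDeriv H f (coordCovDeriv H f Y w) v u - coordCovDeriv H f Y (christoffel G u v w) u

section Manifold

variable {m n : ℕ}
  {M : Type*} [TopologicalSpace M] [ChartedSpace (EuclideanSpace ℝ (Fin m)) M]
  {N : Type*} [TopologicalSpace N] [ChartedSpace (EuclideanSpace ℝ (Fin n)) N]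

/-! ### Objects on manifolds read in charts

In Mathlib the tangent space `T_p M` is the model space `ℝᵐ`, a tangent vector at `p` being identified
with its coordinates in the preferred chart at `p`. Accordingly the tensors below are evaluated at `p`
by the classical coordinate formulas in the preferred charts at `p` and `φ p`. -/

/-- Fields of bilinear forms on the tangent spaces of `M`. -/
abbrev MetricField (m : ℕ) (M : Type*) [TopologicalSpace M]
    [ChartedSpace (EuclideanSpace ℝ (Fin m)) M] : Type _ :=
  ∀ x : M, TangentSpace (𝓡 m) x →L[ℝ] TangentSpace (𝓡 m) x →L[ℝ] ℝ

/-- Vector fields along a map `φ : M → N`, i.e. sections of `φ⁻¹TN`. -/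
abbrev FieldAlong (φ : M → N) : Type _ := ∀ x : M, TangentSpace (𝓡 n) (φ x)

/-- The coordinates of `p` in the chart at `p`. -/
def coord (p : M) : Euc m := extChartAt (𝓡 m) p p

/-- The differential at `u` of the inverse of the chart at `p`, i.e. the coordinate frame. -/
def chartFrame (p : M) (u : Euc m) :
    Euc m →L[ℝ] TangentSpace (𝓡 m) ((extChartAt (𝓡 m) p).symm u) :=
  mfderiv 𝓘(ℝ, Euc m) (𝓡 m) (extChartAt (𝓡 m) p).symm u

/-- The coordinate expression of `g` in the chart at `p`. -/
def metricInChart (g : MetricField m M) (p : M) (u : Euc m) : Bil m :=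
  ContinuousLinearMap.bilinearComp (E := Euc m) (F := Euc m)
    (g ((extChartAt (𝓡 m) p).symm u)) (chartFrame p u) (chartFrame p u)

/-- The coordinate expression of `φ` in the charts at `p` and `φ p`. -/
def mapInChart (φ : M → N) (p : M) (u : Euc m) : Euc n :=
  extChartAt (𝓡 n) (φ p) (φ ((extChartAt (𝓡 m) p).symm u))

/-- The coordinate expression of a real function in the chart at `p`. -/
def funInChart (f : M → ℝ) (p : M) (u : Euc m) : ℝ := f ((extChartAt (𝓡 m) p).symm u)

/-- The coordinate expression, in the charts at `p` and `φ p`, of a vector field along `φ`. -/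
def fieldInChart {φ : M → N} (X : FieldAlong (n := n) φ) (p : M) (u : Euc m) : Euc n :=
  mfderiv (𝓡 n) 𝓘(ℝ, Euc n) (extChartAt (𝓡 n) (φ p)) (φ ((extChartAt (𝓡 m) p).symm u))
    (X ((extChartAt (𝓡 m) p).symm u))

/-! ### Functions on a Riemannian manifold -/

/-- The gradient of `f`, the vector field with `g(grad f, ·) = df`. -/
def grad (g : MetricField m M) (f : M → ℝ) (p : M) : TangentSpace (𝓡 m) p :=
  sharp (m := m) (g p) (fun z => mfderiv (𝓡 m) 𝓘(ℝ, ℝ) f p z)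

/-- The Laplacian `Δf = Trace_g ∇df`. -/
def laplacian (g : MetricField m M) (f : M → ℝ) (p : M) : ℝ :=
  scalarTrace (m := m) (g p) fun v w =>
    fderiv ℝ (fderiv ℝ (funInChart (m := m) f p)) (coord p) v w
      - fderiv ℝ (funInChart (m := m) f p) (coord p)
          (christoffel (metricInChart g p) (coord p) v w)

/-! ### Maps between Riemannian manifolds -/

/-- The differential `dφ_p : T_p M → T_{φ p} N`. -/
def differential (φ : M → N) (p : M) :
    TangentSpace (𝓡 m) p →L[ℝ] TangentSpace (𝓡 n) (φ p) :=
  mfderiv (𝓡 m) (𝓡 n) φ p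

/-- The pull-back `φ^* h`. -/
def pullbackMetric (h : MetricField n N) (φ : M → N) : MetricField m M := fun p =>
  ContinuousLinearMap.bilinearComp (E := Euc n) (F := Euc n) (E' := Euc m) (F' := Euc m)
    (h (φ p)) (differential φ p) (differential φ p)

/-- The covariant derivative `∇^φ_v X` at `p` of a vector field `X` along `φ`, where `∇^φ` is the
pull-back of the Levi-Civita connection of `h`. -/
def covDerivAlong (h : MetricField n N) {φ : M → N} (X : FieldAlong (n := n) φ) (p : M)
    (v : TangentSpace (𝓡 m) p) : TangentSpace (𝓡 n) (φ p) :=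
  coordCovDeriv (m := m) (n := n) (metricInChart h (φ p)) (mapInChart φ p) (fieldInChart X p) v
    (coord p)

/-- `Trace_g (∇^φ ∇^φ - ∇^φ_{∇^M}) X`. -/
def roughLaplacian (g : MetricField m M) (h : MetricField n N) {φ : M → N}
    (X : FieldAlong (n := n) φ) (p : M) : TangentSpace (𝓡 n) (φ p) :=
  metricTrace (m := m) (n := n) (g p) fun v w =>
    coordSecondCovDeriv (metricInChart g p) (metricInChart h (φ p)) (mapInChart φ p)
      (fieldInChart X p) (coord p) v w

/-- The curvature operator `R^N(X, Y) Z = [∇_X, ∇_Y] Z - ∇_{[X, Y]} Z` of `(N, h)` at `q`. -/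
def curvature (h : MetricField n N) (q : N) (X Y Z : TangentSpace (𝓡 n) q) :
    TangentSpace (𝓡 n) q :=
  coordCurvature (m := n) (metricInChart h q) (coord q) X Y Z

/-- `Trace_g R^N(dφ, X) dφ`. -/
def curvatureTrace (g : MetricField m M) (h : MetricField n N) {φ : M → N}
    (X : FieldAlong (n := n) φ) (p : M) : TangentSpace (𝓡 n) (φ p) :=
  metricTrace (m := m) (n := n) (g p) fun v w =>
    curvature h (φ p) (differential φ p v) (X p) (differential φ p w)

/-- The Jacobi operator
`J^φ_g(X) = -{Trace_g (∇^φ ∇^φ - ∇^φ_{∇^M}) X - Trace_g R^N(dφ, X) dφ}`. -/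
def jacobi (g : MetricField m M) (h : MetricField n N) {φ : M → N}
    (X : FieldAlong (n := n) φ) : FieldAlong (n := n) φ := fun p =>
  -(roughLaplacian g h X p - curvatureTrace g h X p)

/-- The tension field `τ(φ) = Trace_g ∇dφ`, where `∇dφ(v, w) = ∇^φ_v (dφ w) - dφ(∇^M_v w)`. -/
def tension (g : MetricField m M) (h : MetricField n N) (φ : M → N) : FieldAlong (n := n) φ :=
  fun p => metricTrace (m := m) (n := n) (g p) fun v w =>
    coordCovDeriv (metricInChart h (φ p)) (mapInChart φ p)
        (fun u => fderiv ℝ (mapInChart φ p) u w) v (coord p)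
      - fderiv ℝ (mapInChart φ p) (coord p) (christoffel (metricInChart g p) (coord p) v w)

/-- The bitension field
`τ²(φ) = Trace_g (∇^φ ∇^φ - ∇^φ_{∇^M}) τ(φ) - Trace_g R^N(dφ, τ(φ)) dφ`. -/
def bitension (g : MetricField m M) (h : MetricField n N) (φ : M → N) : FieldAlong (n := n) φ :=
  fun p => roughLaplacian g h (tension g h φ) p - curvatureTrace g h (tension g h φ) p

/-- `φ : (M, g) → (N, h)` is biharmonic: its bitension field vanishes identically. -/
def IsBiharmonic (g : MetricField m M) (h : MetricField n N) (φ : M → N) : Prop :=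
  ∀ p, bitension g h φ p = 0

/-! ### Immersions -/

/-- The `h`-orthogonal projection of `ξ ∈ T_{φ p} N` onto the tangent space `dφ(T_p M)` of an
immersion. -/
def tangentPart (h : MetricField n N) (φ : M → N) (p : M) (ξ : TangentSpace (𝓡 n) (φ p)) :
    TangentSpace (𝓡 n) (φ p) :=
  differential (m := m) φ p
    (sharp (m := m) (pullbackMetric (m := m) h φ p) fun z =>
      h (φ p) ξ (differential (m := m) φ p z))

/-- The second fundamental form of the isometric immersion `φ : (M, φ^* h) → (N, h)`: the component
of `∇^φ_v (dφ w)` normal to the immersion. -/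
def secondFundamentalForm (h : MetricField n N) (φ : M → N) (p : M)
    (v w : TangentSpace (𝓡 m) p) : TangentSpace (𝓡 n) (φ p) :=
  let D : TangentSpace (𝓡 n) (φ p) :=
    coordCovDeriv (m := m) (n := n) (metricInChart h (φ p)) (mapInChart φ p)
      (fun u => fderiv ℝ (mapInChart φ p) u w) v (coord p)
  D - tangentPart (m := m) h φ p D

/-- The mean curvature vector `η = (1/m) Trace_{φ^* h} B` of the isometric immersion
`φ : (M, φ^* h) → (N, h)` with second fundamental form `B`. -/
def meanCurvatureVector (h : MetricField n N) (φ : M → N) : FieldAlong (n := n) φ := fun p =>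
  (1 / (m : ℝ)) • metricTrace (m := m) (n := n) (pullbackMetric h φ p)
    (secondFundamentalForm (m := m) h φ p)

/-- A smooth conformal immersion `φ : (M, g) → (N, h)` with `φ^* h = lam² g`, where `lam` is a smooth
positive function. -/
structure IsConformalImmersion (g : MetricField m M) (h : MetricField n N) (φ : M → N)
    (lam : M → ℝ) : Prop where
  smooth : ContMDiff (𝓡 m) (𝓡 n) ∞ φ
  immersion : ∀ p, Function.Injective (differential (m := m) (n := n) φ p)
  smooth_factor : ContMDiff (𝓡 m) 𝓘(ℝ, ℝ) ∞ lam
  factor_pos : ∀ p, 0 < lam p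
  pullback_eq : ∀ p, pullbackMetric h φ p = lam p ^ 2 • g p

end Manifold

end RiemannianMaps

end

open RiemannianMaps

/-! Write c = ln λ, so that ḡ = e^{2c} g, and put V = grad c, W = dφ(V), S = τ(φ, g), T = τ(φ, ḡ).
The equivalence follows from a pointwise identity (`bitension_conformal`): τ²(φ, g) equals λ⁴ τ²(φ,
ḡ) minus the right-hand side of the stated equation.

The Levi-Civita connections of ḡ and g differ by v, w ↦ dc(v) w + dc(w) v - g(v, w) V, whose g-trace
is -(m - 2) V (`metricTrace_map_christoffel_conformal`). Applied to dφ this gives S = λ² T - (m - 2)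
W; applied to v ↦ ∇_v T it relates the rough Laplacians L of g and L̄ of ḡ by λ² L̄ T = L T + (m -
2) ∇_V T. The Hessian of an isometric immersion is normal (`coordHess_normal`), so T = m η.

By linearity of the Jacobi operator, τ²(φ, g) = -J_g(λ² T) + (m - 2) J_g(W). The Leibniz rule gives
L(λ² T) = λ² (L T + 4 ∇_V T + (2 Δc + 4 |V|²) T), while the curvature trace only acquires the factor
λ². Comparison with λ⁴ τ²(φ, ḡ) = λ² (L T + (m - 2) ∇_V T - Trace_g R(dφ, T) dφ) leaves the
coefficient 4 - (m - 2) = -(m - 6) on ∇_V T, which explains the constants in the statement.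

These computations take place in coordinate domains. The transfer to manifolds has one delicate
point: the tension field at each point is computed in that point's own preferred chart, yet the
bitension differentiates it. `fieldCoord_tension` shows that one chart serves all nearby points,
because changes of charts are isometries and hence totally geodesic. -/

noncomputable section

namespace RiemannianMaps

/-! ### Inner products on `ℝᵐ` -/

/-- A bilinear form that is symmetric and positive definite. -/
structure IsInner {m : ℕ} (G : Bil m) : Prop where
  symm : ∀ v w, G v w = G w v
  pos : ∀ v, v ≠ 0 → 0 < G v v

/-! ### Gram matrices, raised indices and traces. -/

section LinearAlgebra

variable {m n : ℕ}

theorem sum_stdVec (x : Euc m) : ∑ i, x i • (stdVec i : Euc m) = x := by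
  have := (EuclideanSpace.basisFun (Fin m) ℝ).sum_repr x
  simpa [stdVec] using this

/-- Nondegeneracy, from positivity at `x - y`. It lets identities between Christoffel vectors be
checked after lowering the index, without inverse Gram matrices. -/
theorem IsInner.eq_of_forall {G : Bil m} (hG : IsInner G) {x y : Euc m}
    (hxy : ∀ z, G x z = G y z) : x = y := by
  by_contra hne
  have h1 := hG.pos (x - y) (sub_ne_zero.2 hne)
  have h2 : G (x - y) (x - y) = 0 := by
    simp [map_sub, hxy]
  exact h1.ne' h2

theorem IsInner.smul {G : Bil m} (hG : IsInner G) {c : ℝ} (hc : 0 < c) : IsInner (c • G) where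
  symm v w := by simp [hG.symm v w]
  pos v hv := by simpa using mul_pos hc (hG.pos v hv)

theorem IsInner.comp {H : Bil n} (hH : IsInner H) (A : Euc m →L[ℝ] Euc n)
    (hA : Function.Injective A) : IsInner (H.bilinearComp A A) where
  symm v w := by simp [hH.symm (A v) (A w)]
  pos v hv := by
    have : A v ≠ 0 := fun h0 => hv (hA (by rw [h0, map_zero]))
    simpa using hH.pos _ this

/-- A kernel vector of the Gram matrix is `G`-orthogonal to every basis vector, hence to itself. -/
theorem IsInner.det_ne_zero {G : Bil m} (hG : IsInner G) : (gram G).det ≠ 0 := by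
  intro h0
  obtain ⟨v, hv, hv0⟩ := Matrix.exists_mulVec_eq_zero_iff.2 h0
  set x : Euc m := WithLp.toLp 2 v with hx
  have hx0 : x ≠ 0 := by
    intro h
    apply hv
    have := congrArg (WithLp.ofLp) h
    simpa [hx] using this
  have key : ∀ i, G (stdVec i) x = 0 := by
    intro i
    have := congrFun hv0 i
    rw [← sum_stdVec x, map_sum]
    simpa [Matrix.mulVec, dotProduct, gram, hx, mul_comm] using this
  have h1 := hG.pos x hx0
  have h2 : G x x = 0 := by
    conv_lhs => rw [← sum_stdVec x]
    rw [sum_stdVec, hG.symm]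
    nth_rewrite 2 [← sum_stdVec x]
    rw [map_sum]
    refine Finset.sum_eq_zero fun i _ => ?_
    rw [map_smul, hG.symm, key, smul_zero]
  exact h1.ne' h2

theorem IsInner.isUnit_det {G : Bil m} (hG : IsInner G) : IsUnit (gram G).det :=
  isUnit_iff_ne_zero.2 hG.det_ne_zero

theorem IsInner.gram_transpose {G : Bil m} (hG : IsInner G) : (gram G).transpose = gram G := by
  ext i j
  simp [gram, hG.symm (stdVec j) (stdVec i)]

theorem IsInner.inv_symm {G : Bil m} (hG : IsInner G) (i j : Fin m) :
    (gram G)⁻¹ i j = (gram G)⁻¹ j i := by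
  have h : ((gram G)⁻¹).transpose = (gram G)⁻¹ := by
    rw [Matrix.transpose_nonsing_inv, hG.gram_transpose]
  exact congrFun (congrFun h j) i

theorem gram_smul (c : ℝ) (G : Bil m) : gram (c • G) = c • gram G := by
  ext i j; simp [gram]

theorem gram_smul_inv {c : ℝ} (hc : c ≠ 0) (G : Bil m) :
    (gram (c • G))⁻¹ = c⁻¹ • (gram G)⁻¹ := by
  rw [gram_smul]
  by_cases h : IsUnit (gram G).det
  · have := invertibleOfNonzero hc
    rw [Matrix.inv_smul _ _ h, invOf_eq_inv]
  -- In the singular case both matrix inverses are zero by convention.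
  · have h2 : ¬ IsUnit (c • gram G).det := by
      rw [Matrix.det_smul, isUnit_iff_ne_zero] at *
      intro h3
      exact h (right_ne_zero_of_mul h3)
    rw [Matrix.nonsing_inv_apply_not_isUnit _ h, Matrix.nonsing_inv_apply_not_isUnit _ h2, smul_zero]

/-- The index-raised vector represents the functional. -/
theorem IsInner.sharp_spec {G : Bil m} (hG : IsInner G) (ℓ : Euc m →ₗ[ℝ] ℝ) (z : Euc m) :
    G (sharp G ℓ) z = ℓ z := by
  have key : ∀ k, G (sharp G ℓ) (stdVec k) = ℓ (stdVec k) := by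
    intro k
    have h1 := Matrix.nonsing_inv_mul (gram G) hG.isUnit_det
    have h2 : ∀ j, ∑ i, (gram G)⁻¹ i j * G (stdVec i) (stdVec k) = if j = k then 1 else 0 := by
      intro j
      have h3 := congrFun (congrFun h1 j) k
      rw [Matrix.mul_apply, Matrix.one_apply] at h3
      rw [← h3]
      refine Finset.sum_congr rfl fun i _ => ?_
      rw [hG.inv_symm]; rfl
    simp only [sharp, map_sum, map_smul, sum_apply,
      smul_apply, smul_eq_mul]
    rw [Finset.sum_comm]
    calc _ = ∑ j, ℓ (stdVec j) * ∑ i, (gram G)⁻¹ i j * G (stdVec i) (stdVec k) := by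
            refine Finset.sum_congr rfl fun j _ => ?_
            rw [Finset.mul_sum]
            exact Finset.sum_congr rfl fun i _ => by ring
      _ = _ := by simp [h2]
  conv_lhs => rw [← sum_stdVec z]
  conv_rhs => rw [← sum_stdVec z]
  simp only [map_sum, map_smul, key]

theorem IsInner.sharp_unique {G : Bil m} (hG : IsInner G) (ℓ : Euc m →ₗ[ℝ] ℝ) {x : Euc m}
    (hx : ∀ z, G x z = ℓ z) : sharp G ℓ = x :=
  hG.eq_of_forall fun z => by rw [hG.sharp_spec, hx]

theorem sharp_add (G : Bil m) (a b : Euc m → ℝ) :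
    sharp G (fun z => a z + b z) = sharp G a + sharp G b := by
  simp [sharp, mul_add, add_smul, Finset.sum_add_distrib]

theorem sharp_const_mul (G : Bil m) (c : ℝ) (a : Euc m → ℝ) :
    sharp G (fun z => c * a z) = c • sharp G a := by
  simp only [sharp, Finset.smul_sum, smul_smul]
  refine Finset.sum_congr rfl fun i _ => Finset.sum_congr rfl fun j _ => ?_
  congr 1; ring

/-! ### Traces -/

theorem metricTrace_add (G : Bil m) (A B : Euc m → Euc m → Euc n) :
    metricTrace G (fun v w => A v w + B v w) = metricTrace G A + metricTrace G B := by
  simp [metricTrace, smul_add, Finset.sum_add_distrib]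

theorem metricTrace_sub (G : Bil m) (A B : Euc m → Euc m → Euc n) :
    metricTrace G (fun v w => A v w - B v w) = metricTrace G A - metricTrace G B := by
  simp [metricTrace, smul_sub, Finset.sum_sub_distrib]

theorem metricTrace_smul (G : Bil m) (c : ℝ) (A : Euc m → Euc m → Euc n) :
    metricTrace G (fun v w => c • A v w) = c • metricTrace G A := by
  simp only [metricTrace, Finset.smul_sum]
  exact Finset.sum_congr rfl fun i _ => Finset.sum_congr rfl fun j _ => smul_comm _ _ _

theorem metricTrace_smul_const (G : Bil m) (b : Euc m → Euc m → ℝ) (x : Euc n) :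
    metricTrace G (fun v w => b v w • x) = scalarTrace G b • x := by
  simp only [metricTrace, scalarTrace, Finset.sum_smul, smul_smul]

theorem metricTrace_map {k : ℕ} (G : Bil m) (L : Euc n →L[ℝ] Euc k) (A : Euc m → Euc m → Euc n) :
    metricTrace G (fun v w => L (A v w)) = L (metricTrace G A) := by
  simp only [metricTrace, map_sum, map_smul]

theorem metricTrace_smul_metric {c : ℝ} (hc : c ≠ 0) (G : Bil m) (A : Euc m → Euc m → Euc n) :
    metricTrace (c • G) A = c⁻¹ • metricTrace G A := by
  simp only [metricTrace, gram_smul_inv hc, Finset.smul_sum, Matrix.smul_apply, smul_smul,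
    smul_eq_mul]

theorem metricTrace_congr {G : Bil m} {A B : Euc m → Euc m → Euc n} (hAB : ∀ v w, A v w = B v w) :
    metricTrace G A = metricTrace G B := by
  simp only [metricTrace, hAB]

theorem IsInner.scalarTrace_self {G : Bil m} (hG : IsInner G) :
    scalarTrace G (fun v w => G v w) = m := by
  have h1 := Matrix.nonsing_inv_mul (gram G) hG.isUnit_det
  have h2 := congrArg Matrix.trace h1
  rw [Matrix.trace_one, Fintype.card_fin] at h2
  rw [← h2, Matrix.trace]
  refine Finset.sum_congr rfl fun i _ => ?_
  rw [Matrix.diag_apply, Matrix.mul_apply]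
  refine Finset.sum_congr rfl fun j _ => ?_
  exact congrArg _ (hG.symm _ _)

/-- The functional sits in the second slot, exactly as in the double sum defining `sharp`, so no
symmetry of `G` is needed; the mirrored version below does need it. -/
theorem metricTrace_smul_right (G : Bil m) (a : Euc m → ℝ) (L : Euc m →ₗ[ℝ] Euc n) :
    metricTrace G (fun v w => a w • L v) = L (sharp G a) := by
  simp only [metricTrace, sharp, map_sum, map_smul, smul_smul]

theorem IsInner.metricTrace_flip {G : Bil m} (hG : IsInner G) (A : Euc m → Euc m → Euc n) :
    metricTrace G (fun v w => A w v) = metricTrace G A := by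
  rw [metricTrace, Finset.sum_comm]
  refine Finset.sum_congr rfl fun i _ => Finset.sum_congr rfl fun j _ => ?_
  rw [hG.inv_symm]

theorem IsInner.metricTrace_smul_left {G : Bil m} (hG : IsInner G) (a : Euc m → ℝ)
    (L : Euc m →ₗ[ℝ] Euc n) :
    metricTrace G (fun v w => a v • L w) = L (sharp G a) := by
  rw [← metricTrace_smul_right, ← hG.metricTrace_flip]

/-- The trace does not depend on the linear coordinates. -/
theorem IsInner.metricTrace_comp {G : Bil m} (hG : IsInner G) (A : Euc m →L[ℝ] Euc m)
    (hA : Function.Injective A) (B : Euc m →ₗ[ℝ] Euc m →ₗ[ℝ] Euc n) :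
    metricTrace (G.bilinearComp A A) (fun v w => B (A v) (A w)) =
      metricTrace G (fun v w => B v w) := by
  set a : Matrix (Fin m) (Fin m) ℝ := Matrix.of fun k i => (A (stdVec i)) k with ha
  have hAe : ∀ i, A (stdVec i) = ∑ k, a k i • stdVec k := fun i =>
    (sum_stdVec (A (stdVec i))).symm
  have hgram : gram (G.bilinearComp A A) = a.transpose * gram G * a := by
    ext i j
    rw [Matrix.mul_apply]
    simp only [gram, Matrix.of_apply, ContinuousLinearMap.bilinearComp_apply, Matrix.mul_apply,
      Matrix.transpose_apply]
    rw [hAe j, map_sum]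
    refine Finset.sum_congr rfl fun k _ => ?_
    rw [map_smul, hAe i, map_sum, sum_apply, smul_eq_mul, mul_comm]
    congr 1
    exact Finset.sum_congr rfl fun l _ => by simp
  -- The pulled-back form is again an inner product, so its determinant, a product containing
  -- `a.det`, is nonzero.
  have hdet : IsUnit a.det := by
    have h1 := (hG.comp A hA).det_ne_zero
    rw [hgram, Matrix.det_mul] at h1
    exact isUnit_iff_ne_zero.2 (right_ne_zero_of_mul h1)
  -- The inverse Gram matrix transforms contravariantly, which cancels the two factors `A` in the
  -- arguments of `B`.
  have hinv : a * (gram (G.bilinearComp A A))⁻¹ * a.transpose = (gram G)⁻¹ := by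
    rw [hgram, Matrix.mul_inv_rev, Matrix.mul_inv_rev, ← mul_assoc, Matrix.mul_nonsing_inv _ hdet,
      one_mul, mul_assoc, Matrix.nonsing_inv_mul, mul_one]
    rwa [Matrix.det_transpose]
  have hentry : ∀ k l, (gram G)⁻¹ k l =
      ∑ i, ∑ j, (gram (G.bilinearComp A A))⁻¹ i j * (a k i * a l j) := by
    intro k l
    rw [← hinv, Matrix.mul_apply, Finset.sum_comm]
    refine Finset.sum_congr rfl fun j _ => ?_
    rw [Matrix.mul_apply, Finset.sum_mul]
    exact Finset.sum_congr rfl fun i _ => by rw [Matrix.transpose_apply]; ring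
  simp only [metricTrace, hentry, hAe, map_sum, map_smul, LinearMap.sum_apply, LinearMap.smul_apply,
    Finset.smul_sum, Finset.sum_smul, smul_smul]
  have swap : ∀ (f : Fin m → Fin m → Fin m → Fin m → Euc n),
      ∑ i, ∑ j, ∑ k, ∑ l, f i j k l = ∑ k, ∑ l, ∑ i, ∑ j, f i j k l := by
    intro f
    calc _ = ∑ i, ∑ k, ∑ j, ∑ l, f i j k l := Finset.sum_congr rfl fun i _ => Finset.sum_comm
      _ = ∑ k, ∑ i, ∑ j, ∑ l, f i j k l := Finset.sum_comm
      _ = ∑ k, ∑ i, ∑ l, ∑ j, f i j k l := Finset.sum_congr rfl fun k _ =>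
          Finset.sum_congr rfl fun i _ => Finset.sum_comm
      _ = _ := Finset.sum_congr rfl fun k _ => Finset.sum_comm
  rw [swap, Finset.sum_comm]
  refine Finset.sum_congr rfl fun k _ => Finset.sum_congr rfl fun l _ =>
    Finset.sum_congr rfl fun i _ => Finset.sum_congr rfl fun j _ => ?_
  congr 1
  ring

end LinearAlgebra

/-! ### Riemannian calculus in coordinate domains. -/

section Calculus

open Filter Topology

variable {m n k : ℕ}

/-! ### Christoffel symbols -/

/-- The Christoffel symbols of the first kind as a linear form in the last argument. -/
def christoffelForm (G : Euc m → Bil m) (u v w : Euc m) : Euc m →ₗ[ℝ] ℝ where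
  toFun := christoffelFirst G u v w
  map_add' x y := by simp [christoffelFirst]; ring
  map_smul' c x := by simp [christoffelFirst]; ring

theorem IsInner.christoffel_spec {G : Euc m → Bil m} {u : Euc m} (hG : IsInner (G u))
    (v w z : Euc m) : G u (christoffel G u v w) z = christoffelFirst G u v w z :=
  hG.sharp_spec (christoffelForm G u v w) z

theorem christoffel_add_left (G : Euc m → Bil m) (u v v' w : Euc m) :
    christoffel G u (v + v') w = christoffel G u v w + christoffel G u v' w := by
  rw [christoffel, christoffel, christoffel, ← sharp_add]
  congr 1; funext z
  simp [christoffelFirst]; ring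

theorem christoffel_smul_left (G : Euc m → Bil m) (u v w : Euc m) (c : ℝ) :
    christoffel G u (c • v) w = c • christoffel G u v w := by
  rw [christoffel, christoffel, ← sharp_const_mul]
  congr 1; funext z
  simp [christoffelFirst]; ring

theorem christoffel_add_right (G : Euc m → Bil m) (u v w w' : Euc m) :
    christoffel G u v (w + w') = christoffel G u v w + christoffel G u v w' := by
  rw [christoffel, christoffel, christoffel, ← sharp_add]
  congr 1; funext z
  simp [christoffelFirst]; ring

theorem christoffel_smul_right (G : Euc m → Bil m) (u v w : Euc m) (c : ℝ) :
    christoffel G u v (c • w) = c • christoffel G u v w := by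
  rw [christoffel, christoffel, ← sharp_const_mul]
  congr 1; funext z
  simp [christoffelFirst]; ring

/-- The Christoffel symbols as a bilinear map. -/
def christoffelBilin (G : Euc m → Bil m) (u : Euc m) : Euc m →ₗ[ℝ] Euc m →ₗ[ℝ] Euc m :=
  LinearMap.mk₂ ℝ (christoffel G u) (christoffel_add_left G u)
    (fun c v w => christoffel_smul_left G u v w c) (christoffel_add_right G u)
    (fun c v w => christoffel_smul_right G u v w c)

@[simp] theorem christoffelBilin_apply (G : Euc m → Bil m) (u v w : Euc m) :
    christoffelBilin G u v w = christoffel G u v w := rfl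

/-- Separates the dependence on the point from that on the vectors, so smoothness with varying
arguments reduces to constant ones. -/
theorem christoffel_eq_sum (G : Euc m → Bil m) (u v w : Euc m) :
    christoffel G u v w = ∑ i, ∑ j, v i • w j • christoffel G u (stdVec i) (stdVec j) := by
  rw [← christoffelBilin_apply]
  conv_lhs => rw [← sum_stdVec v, ← sum_stdVec w]
  simp only [map_sum, map_smul, LinearMap.sum_apply, LinearMap.smul_apply,
    Finset.smul_sum, christoffelBilin_apply]
  rw [Finset.sum_comm]
  exact Finset.sum_congr rfl fun i _ => Finset.sum_congr rfl fun j _ => smul_comm _ _ _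

theorem contDiffAt_det {E : Type*} [NormedAddCommGroup E] [NormedSpace ℝ E]
    {A : E → Matrix (Fin m) (Fin m) ℝ} {u : E}
    (hA : ∀ i j, ContDiffAt ℝ ∞ (fun y => A y i j) u) :
    ContDiffAt ℝ ∞ (fun y => (A y).det) u := by
  simp only [Matrix.det_apply]
  refine ContDiffAt.sum fun σ _ => ContDiffAt.const_smul _ ?_
  exact contDiffAt_prod fun i _ => hA _ _

/-- Cramer's rule: entries of the inverse are determinants divided by a nonvanishing determinant. -/
theorem contDiffAt_inv_matrix {E : Type*} [NormedAddCommGroup E] [NormedSpace ℝ E]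
    {A : E → Matrix (Fin m) (Fin m) ℝ} {u : E}
    (hA : ∀ i j, ContDiffAt ℝ ∞ (fun y => A y i j) u) (h0 : (A u).det ≠ 0) (i j : Fin m) :
    ContDiffAt ℝ ∞ (fun y => (A y)⁻¹ i j) u := by
  simp only [Matrix.inv_def, Ring.inverse_eq_inv', Matrix.smul_apply, smul_eq_mul,
    Matrix.adjugate_apply]
  refine ((contDiffAt_det hA).inv h0).mul (contDiffAt_det fun a b => ?_)
  by_cases h : a = j
  · subst h
    simp only [Matrix.updateRow_self]
    exact contDiffAt_const
  · simp only [Matrix.updateRow_ne h]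
    exact hA a b

theorem contDiffAt_gram_inv {G : Euc m → Bil m} {u : Euc m} (hG : ContDiffAt ℝ ∞ G u)
    (hi : IsInner (G u)) (i j : Fin m) : ContDiffAt ℝ ∞ (fun y => (gram (G y))⁻¹ i j) u := by
  refine contDiffAt_inv_matrix (A := fun y => gram (G y)) (fun a b => ?_) hi.det_ne_zero i j
  simp only [gram, Matrix.of_apply]
  exact (hG.clm_apply contDiffAt_const).clm_apply contDiffAt_const

theorem contDiffAt_christoffel_const {G : Euc m → Bil m} {u : Euc m} (hG : ContDiffAt ℝ ∞ G u)
    (hi : IsInner (G u)) (v w : Euc m) : ContDiffAt ℝ ∞ (fun y => christoffel G y v w) u := by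
  have hd : ∀ a b c, ContDiffAt ℝ ∞ (fun y => fderiv ℝ G y a b c) u := fun a b c =>
    (((hG.fderiv_right (m := ∞) le_rfl).clm_apply contDiffAt_const).clm_apply
      contDiffAt_const).clm_apply contDiffAt_const
  unfold christoffel sharp christoffelFirst
  refine ContDiffAt.sum fun i _ => ContDiffAt.sum fun j _ =>
    ContDiffAt.fun_smul ?_ contDiffAt_const
  exact (contDiffAt_gram_inv hG hi i j).mul
    (contDiffAt_const.mul (((hd _ _ _).add (hd _ _ _)).sub (hd _ _ _)))

theorem contDiffAt_coord {E : Type*} [NormedAddCommGroup E] [NormedSpace ℝ E]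
    {f : E → Euc n} {u : E} (hf : ContDiffAt ℝ ∞ f u) (i : Fin n) :
    ContDiffAt ℝ ∞ (fun y => f y i) u :=
  (EuclideanSpace.proj (𝕜 := ℝ) i).contDiff.contDiffAt.comp u hf

theorem contDiffAt_christoffel {H : Euc n → Bil n} {f a b : Euc m → Euc n} {u : Euc m}
    (hH : ContDiffAt ℝ ∞ H (f u)) (hi : IsInner (H (f u))) (hf : ContDiffAt ℝ ∞ f u)
    (ha : ContDiffAt ℝ ∞ a u) (hb : ContDiffAt ℝ ∞ b u) :
    ContDiffAt ℝ ∞ (fun y => christoffel H (f y) (a y) (b y)) u := by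
  simp only [fun y => christoffel_eq_sum H (f y) (a y) (b y)]
  refine ContDiffAt.sum fun i _ => ContDiffAt.sum fun j _ => ?_
  exact (contDiffAt_coord ha i).smul ((contDiffAt_coord hb j).smul
    ((contDiffAt_christoffel_const hH hi _ _).comp u hf))

/-! ### Covariant derivatives in coordinates -/

theorem _root_.ContDiffAt.eventually_differentiableAt {E F : Type*} [NormedAddCommGroup E]
    [NormedSpace ℝ E] [NormedAddCommGroup F] [NormedSpace ℝ F] {f : E → F} {u : E}
    (hf : ContDiffAt ℝ ∞ f u) : ∀ᶠ y in 𝓝 u, DifferentiableAt ℝ f y := by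
  have h1 : ContDiffAt ℝ 1 f u := hf.of_le (by exact_mod_cast le_top)
  exact (h1.eventually (by simp)).mono fun y hy => hy.differentiableAt (by simp)

theorem _root_.ContDiffAt.fderiv_infty {E F : Type*} [NormedAddCommGroup E]
    [NormedSpace ℝ E] [NormedAddCommGroup F] [NormedSpace ℝ F] {f : E → F} {u : E}
    (hf : ContDiffAt ℝ ∞ f u) : ContDiffAt ℝ ∞ (fderiv ℝ f) u :=
  hf.fderiv_right (m := ∞) le_rfl

theorem contDiffAt_coordCovDeriv {H : Euc n → Bil n} {f Y : Euc m → Euc n} {u : Euc m}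
    (hH : ContDiffAt ℝ ∞ H (f u)) (hi : IsInner (H (f u))) (hf : ContDiffAt ℝ ∞ f u)
    (hY : ContDiffAt ℝ ∞ Y u) (v : Euc m) : ContDiffAt ℝ ∞ (coordCovDeriv H f Y v) u := by
  unfold coordCovDeriv
  exact (hY.fderiv_infty.clm_apply contDiffAt_const).add
    (contDiffAt_christoffel hH hi hf (hf.fderiv_infty.clm_apply contDiffAt_const) hY)

theorem coordCovDeriv_congr {H : Euc n → Bil n} {f Y Y' : Euc m → Euc n} {u : Euc m}
    (h : Y =ᶠ[𝓝 u] Y') (v : Euc m) : coordCovDeriv H f Y v u = coordCovDeriv H f Y' v u := by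
  simp only [coordCovDeriv, h.fderiv_eq, h.eq_of_nhds]

/-- `v ↦ ∇_v Y` as a linear map. -/
def coordCovDerivLin (H : Euc n → Bil n) (f Y : Euc m → Euc n) (u : Euc m) :
    Euc m →ₗ[ℝ] Euc n where
  toFun v := coordCovDeriv H f Y v u
  map_add' v w := by simp only [coordCovDeriv, map_add, christoffel_add_left]; abel
  map_smul' c v := by
    simp only [coordCovDeriv, map_smul, christoffel_smul_left, RingHom.id_apply, smul_add]

@[simp] theorem coordCovDerivLin_apply (H : Euc n → Bil n) (f Y : Euc m → Euc n) (u v : Euc m) :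
    coordCovDerivLin H f Y u v = coordCovDeriv H f Y v u := rfl

theorem coordCovDeriv_add {H : Euc n → Bil n} {f Y Z : Euc m → Euc n} {u : Euc m}
    (hY : DifferentiableAt ℝ Y u) (hZ : DifferentiableAt ℝ Z u) (v : Euc m) :
    coordCovDeriv H f (fun y => Y y + Z y) v u = coordCovDeriv H f Y v u + coordCovDeriv H f Z v u := by
  simp only [coordCovDeriv, fderiv_fun_add hY hZ, add_apply, christoffel_add_right]
  abel

theorem coordCovDeriv_smul {H : Euc n → Bil n} {f Y : Euc m → Euc n} {a : Euc m → ℝ} {u : Euc m}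
    (ha : DifferentiableAt ℝ a u) (hY : DifferentiableAt ℝ Y u) (v : Euc m) :
    coordCovDeriv H f (fun y => a y • Y y) v u =
      a u • coordCovDeriv H f Y v u + fderiv ℝ a u v • Y u := by
  simp only [coordCovDeriv, fderiv_fun_smul ha hY, add_apply, smul_apply,
    christoffel_smul_right, ContinuousLinearMap.smulRight_apply, smul_add]
  abel

theorem coordSecondCovDeriv_add {G : Euc m → Bil m} {H : Euc n → Bil n} {f Y Z : Euc m → Euc n}
    {u : Euc m} (hH : ContDiffAt ℝ ∞ H (f u)) (hi : IsInner (H (f u))) (hf : ContDiffAt ℝ ∞ f u)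
    (hY : ContDiffAt ℝ ∞ Y u) (hZ : ContDiffAt ℝ ∞ Z u) (v w : Euc m) :
    coordSecondCovDeriv G H f (fun y => Y y + Z y) u v w =
      coordSecondCovDeriv G H f Y u v w + coordSecondCovDeriv G H f Z u v w := by
  -- The inner derivative is differentiated again, so additivity is needed on a neighbourhood and
  -- not only at `u`.
  have h1 : coordCovDeriv H f (fun y => Y y + Z y) w =ᶠ[𝓝 u]
      fun y => coordCovDeriv H f Y w y + coordCovDeriv H f Z w y := by
    filter_upwards [hY.eventually_differentiableAt, hZ.eventually_differentiableAt] with y h h'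
    exact coordCovDeriv_add h h' w
  have hd : ∀ {Y}, ContDiffAt ℝ ∞ Y u → DifferentiableAt ℝ (coordCovDeriv H f Y w) u := fun hY =>
    (contDiffAt_coordCovDeriv hH hi hf hY w).differentiableAt (by simp)
  simp only [coordSecondCovDeriv, coordCovDeriv_congr h1]
  rw [coordCovDeriv_add (hd hY) (hd hZ), coordCovDeriv_add (hY.differentiableAt (by simp))
    (hZ.differentiableAt (by simp))]
  abel

/-- The Leibniz rule for second covariant derivatives. -/
theorem coordSecondCovDeriv_smul {G : Euc m → Bil m} {H : Euc n → Bil n} {f Y : Euc m → Euc n}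
    {a : Euc m → ℝ} {u : Euc m} (hH : ContDiffAt ℝ ∞ H (f u)) (hi : IsInner (H (f u)))
    (hf : ContDiffAt ℝ ∞ f u) (ha : ContDiffAt ℝ ∞ a u) (hY : ContDiffAt ℝ ∞ Y u) (v w : Euc m) :
    coordSecondCovDeriv G H f (fun y => a y • Y y) u v w =
      a u • coordSecondCovDeriv G H f Y u v w
        + (fderiv ℝ a u v • coordCovDeriv H f Y w u + fderiv ℝ a u w • coordCovDeriv H f Y v u
          + (fderiv ℝ (fderiv ℝ a) u v w - fderiv ℝ a u (christoffel G u v w)) • Y u) := by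
  have hY1 : DifferentiableAt ℝ Y u := hY.differentiableAt (by simp)
  have ha1 : DifferentiableAt ℝ a u := ha.differentiableAt (by simp)
  have ha2 : DifferentiableAt ℝ (fderiv ℝ a) u := ha.fderiv_infty.differentiableAt (by simp)
  have h1 : coordCovDeriv H f (fun y => a y • Y y) w =ᶠ[𝓝 u]
      fun y => a y • coordCovDeriv H f Y w y + fderiv ℝ a y w • Y y := by
    filter_upwards [hY.eventually_differentiableAt, ha.eventually_differentiableAt] with y h h'
    exact coordCovDeriv_smul h' h w
  have hd : DifferentiableAt ℝ (coordCovDeriv H f Y w) u :=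
    (contDiffAt_coordCovDeriv hH hi hf hY w).differentiableAt (by simp)
  have ha3 : DifferentiableAt ℝ (fun y => fderiv ℝ a y w) u :=
    ha2.clm_apply (differentiableAt_const w)
  have ha4 : fderiv ℝ (fun y => fderiv ℝ a y w) u v = fderiv ℝ (fderiv ℝ a) u v w := by
    rw [fderiv_clm_apply ha2 (differentiableAt_const w)]
    simp
  simp only [coordSecondCovDeriv, coordCovDeriv_congr h1]
  rw [coordCovDeriv_add (ha1.fun_smul hd) (ha3.fun_smul hY1), coordCovDeriv_smul ha1 hd,
    coordCovDeriv_smul ha3 hY1, coordCovDeriv_smul ha1 hY1, ha4]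
  simp only [sub_smul, smul_sub]
  abel

/-! ### The Hessian of a map -/

/-- The second fundamental form `∇df(v, w) = ∇^f_v (df w) - df(∇_v w)` of a map between coordinate
domains. -/
def coordHess (G : Euc m → Bil m) (H : Euc n → Bil n) (f : Euc m → Euc n) (u v w : Euc m) : Euc n :=
  coordCovDeriv H f (fun y => fderiv ℝ f y w) v u - fderiv ℝ f u (christoffel G u v w)

theorem coordCovDeriv_fderiv {H : Euc n → Bil n} {f : Euc m → Euc n} {u : Euc m}
    (hf : ContDiffAt ℝ ∞ f u) (v w : Euc m) :
    coordCovDeriv H f (fun y => fderiv ℝ f y w) v u =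
      fderiv ℝ (fderiv ℝ f) u v w + christoffel H (f u) (fderiv ℝ f u v) (fderiv ℝ f u w) := by
  rw [coordCovDeriv, fderiv_clm_apply (hf.fderiv_infty.differentiableAt (by simp))
    (differentiableAt_const w)]
  simp

theorem coordHess_eq {G : Euc m → Bil m} {H : Euc n → Bil n} {f : Euc m → Euc n} {u : Euc m}
    (hf : ContDiffAt ℝ ∞ f u) (v w : Euc m) :
    coordHess G H f u v w = fderiv ℝ (fderiv ℝ f) u v w
      + christoffel H (f u) (fderiv ℝ f u v) (fderiv ℝ f u w)
      - fderiv ℝ f u (christoffel G u v w) := by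
  rw [coordHess, coordCovDeriv_fderiv hf]

/-- `∇df` as a bilinear map. -/
def coordHessBilin (G : Euc m → Bil m) (H : Euc n → Bil n) (f : Euc m → Euc n) (u : Euc m) :
    Euc m →ₗ[ℝ] Euc m →ₗ[ℝ] Euc n :=
  LinearMap.mk₂ ℝ (fun v w => fderiv ℝ (fderiv ℝ f) u v w
      + christoffel H (f u) (fderiv ℝ f u v) (fderiv ℝ f u w)
      - fderiv ℝ f u (christoffel G u v w))
    (fun v v' w => by simp only [map_add, add_apply, christoffel_add_left]; abel)
    (fun c v w => by simp only [map_smul, smul_apply, christoffel_smul_left, smul_add, smul_sub])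
    (fun v w w' => by simp only [map_add, christoffel_add_right]; abel)
    (fun c v w => by simp only [map_smul, christoffel_smul_right, smul_add, smul_sub])

theorem coordHessBilin_apply {G : Euc m → Bil m} {H : Euc n → Bil n} {f : Euc m → Euc n}
    {u : Euc m} (hf : ContDiffAt ℝ ∞ f u) (v w : Euc m) :
    coordHessBilin G H f u v w = coordHess G H f u v w := by
  rw [coordHess_eq hf]; rfl

theorem contDiffAt_coordHess {G : Euc m → Bil m} {H : Euc n → Bil n} {f : Euc m → Euc n}
    {u : Euc m} (hG : ContDiffAt ℝ ∞ G u) (hGi : IsInner (G u)) (hH : ContDiffAt ℝ ∞ H (f u))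
    (hHi : IsInner (H (f u))) (hf : ContDiffAt ℝ ∞ f u) (v w : Euc m) :
    ContDiffAt ℝ ∞ (fun y => coordHess G H f y v w) u := by
  unfold coordHess
  exact (contDiffAt_coordCovDeriv hH hHi hf (hf.fderiv_infty.clm_apply contDiffAt_const) v).sub
    (hf.fderiv_infty.clm_apply (contDiffAt_christoffel_const hG hGi v w))

/-- The tension field in coordinates. -/
def coordTension (G : Euc m → Bil m) (H : Euc n → Bil n) (f : Euc m → Euc n) (u : Euc m) : Euc n :=
  metricTrace (G u) (coordHess G H f u)

theorem contDiffAt_coordTension {G : Euc m → Bil m} {H : Euc n → Bil n} {f : Euc m → Euc n}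
    {u : Euc m} (hG : ContDiffAt ℝ ∞ G u) (hGi : IsInner (G u)) (hH : ContDiffAt ℝ ∞ H (f u))
    (hHi : IsInner (H (f u))) (hf : ContDiffAt ℝ ∞ f u) :
    ContDiffAt ℝ ∞ (coordTension G H f) u := by
  unfold coordTension metricTrace
  exact ContDiffAt.sum fun i _ => ContDiffAt.sum fun j _ =>
    (contDiffAt_gram_inv hG hGi i j).smul (contDiffAt_coordHess hG hGi hH hHi hf _ _)

/-- Chain rule twice. The Christoffel term of the intermediate metric `H` enters the two right-hand
terms with opposite signs and cancels, so `H` may be arbitrary. -/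
theorem coordHess_comp {G : Euc m → Bil m} {H : Euc n → Bil n} {K : Euc k → Bil k}
    {f : Euc m → Euc n} {g : Euc n → Euc k} {u : Euc m} (hf : ContDiffAt ℝ ∞ f u)
    (hg : ContDiffAt ℝ ∞ g (f u)) (v w : Euc m) :
    coordHess G K (g ∘ f) u v w = fderiv ℝ g (f u) (coordHess G H f u v w)
      + coordHess H K g (f u) (fderiv ℝ f u v) (fderiv ℝ f u w) := by
  have hf1 := hf.differentiableAt (n := ∞) (by simp)
  have hf2 := hf.fderiv_infty.differentiableAt (n := ∞) (by simp)
  have hg1 := hg.differentiableAt (n := ∞) (by simp)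
  have hg2 := hg.fderiv_infty.differentiableAt (n := ∞) (by simp)
  have h1 : fderiv ℝ (g ∘ f) =ᶠ[𝓝 u] fun y => (fderiv ℝ g (f y)).comp (fderiv ℝ f y) := by
    filter_upwards [hf.eventually_differentiableAt,
      hf.continuousAt.eventually hg.eventually_differentiableAt] with y h h'
    exact fderiv_comp y h' h
  have h2 : fderiv ℝ (fderiv ℝ (g ∘ f)) u v w =
      fderiv ℝ (fderiv ℝ g) (f u) (fderiv ℝ f u v) (fderiv ℝ f u w)
        + fderiv ℝ g (f u) (fderiv ℝ (fderiv ℝ f) u v w) := by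
    have hg3 : DifferentiableAt ℝ (fun y => fderiv ℝ g (f y)) u := hg2.comp u hf1
    have hg4 : fderiv ℝ (fun y => fderiv ℝ g (f y)) u =
        (fderiv ℝ (fderiv ℝ g) (f u)).comp (fderiv ℝ f u) := fderiv_comp u hg2 hf1
    rw [h1.fderiv_eq, fderiv_clm_comp hg3 hf2, hg4]
    simp [add_comm]
  rw [coordHess_eq (hg.comp u hf), coordHess_eq hf, coordHess_eq hg, h2, h1.eq_of_nhds]
  simp only [Function.comp_apply, ContinuousLinearMap.comp_apply, map_add, map_sub]
  abel

/-- For an isometric immersion, `∇df` is normal. -/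
theorem coordHess_normal {G : Euc m → Bil m} {H : Euc n → Bil n} {f : Euc m → Euc n} {u : Euc m}
    (hf : ContDiffAt ℝ ∞ f u) (hG : DifferentiableAt ℝ G u) (hH : DifferentiableAt ℝ H (f u))
    (hHi : IsInner (H (f u))) (hGi : IsInner (G u))
    (hiso : ∀ᶠ y in 𝓝 u, G y = (H (f y)).bilinearComp (fderiv ℝ f y) (fderiv ℝ f y))
    (v w z : Euc m) : H (f u) (coordHess G H f u v w) (fderiv ℝ f u z) = 0 := by
  have hf1 := hf.differentiableAt (n := ∞) (by simp)
  have hf2 := hf.fderiv_infty.differentiableAt (n := ∞) (by simp)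
  have hsymm : IsSymmSndFDerivAt ℝ f u := hf.isSymmSndFDerivAt
    (by simp only [minSmoothness_of_isRCLikeNormedField]; exact WithTop.coe_le_coe.2 le_top)
  -- The product rule applied to `G = f^*H`; the last two terms record the second derivative of `f`.
  have hder : ∀ a b c, fderiv ℝ G u a b c =
      fderiv ℝ H (f u) (fderiv ℝ f u a) (fderiv ℝ f u b) (fderiv ℝ f u c)
        + H (f u) (fderiv ℝ (fderiv ℝ f) u a b) (fderiv ℝ f u c)
        + H (f u) (fderiv ℝ f u b) (fderiv ℝ (fderiv ℝ f) u a c) := by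
    intro a b c
    have h1 : (fun y => G y b c) =ᶠ[𝓝 u] fun y => H (f y) (fderiv ℝ f y b) (fderiv ℝ f y c) := by
      filter_upwards [hiso] with y hy
      rw [hy]; rfl
    have h2 : ∀ d, HasFDerivAt (fun y => fderiv ℝ f y d) ((fderiv ℝ (fderiv ℝ f) u).flip d) u :=
      fun d => by simpa using hf2.hasFDerivAt.clm_apply (hasFDerivAt_const d u)
    have h0 : HasFDerivAt (fun y => H (f y)) ((fderiv ℝ H (f u)).comp (fderiv ℝ f u)) u :=
      HasFDerivAt.comp (g := H) u hH.hasFDerivAt hf1.hasFDerivAt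
    have h3 := (h0.clm_apply (h2 b)).clm_apply (h2 c)
    have h4 := (hG.hasFDerivAt.clm_apply (hasFDerivAt_const b u)).clm_apply (hasFDerivAt_const c u)
    have h5 := congrArg (fun L => L a) (h4.unique (h3.congr_of_eventuallyEq h1))
    simp only [add_apply, ContinuousLinearMap.comp_apply,
      ContinuousLinearMap.flip_apply, zero_apply, map_zero, zero_add] at h5
    rw [h5]
    ring
  have hG0 := hGi.christoffel_spec v w z
  have hiso0 : ∀ a b, G u a b = H (f u) (fderiv ℝ f u a) (fderiv ℝ f u b) := fun a b => by
    rw [hiso.self_of_nhds]; rfl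
  rw [coordHess_eq hf]
  simp only [map_add, map_sub, add_apply, sub_apply]
  rw [hHi.christoffel_spec, ← hiso0, hG0]
  simp only [christoffelFirst, hder]
  -- Once second derivatives are symmetric, Koszul's combination of the terms in `hder` retains only
  -- H(f''(v, w), df z), which cancels the Hessian's own second derivative.
  rw [hsymm.eq w v, hsymm.eq z v, hsymm.eq z w, hHi.symm (fderiv ℝ (fderiv ℝ f) u v w),
    hHi.symm (fderiv ℝ f u w) (fderiv ℝ (fderiv ℝ f) u v z)]
  ring

/-- An isometry between domains of the same dimension is totally geodesic. -/
theorem coordHess_isometry {G H : Euc m → Bil m} {f : Euc m → Euc m} {u : Euc m}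
    (hf : ContDiffAt ℝ ∞ f u) (hG : DifferentiableAt ℝ G u) (hH : DifferentiableAt ℝ H (f u))
    (hHi : IsInner (H (f u))) (hGi : IsInner (G u))
    (hiso : ∀ᶠ y in 𝓝 u, G y = (H (f y)).bilinearComp (fderiv ℝ f y) (fderiv ℝ f y))
    (hsurj : Function.Surjective (fderiv ℝ f u)) (v w : Euc m) : coordHess G H f u v w = 0 := by
  refine hHi.eq_of_forall fun z => ?_
  obtain ⟨z, rfl⟩ := hsurj z
  rw [coordHess_normal hf hG hH hHi hGi hiso, map_zero, zero_apply]

/-! ### Conformal changes of the metric -/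

/-- The Christoffel symbols of a conformal metric `e^{2c} G`. -/
theorem christoffel_conformal {G Gb : Euc m → Bil m} {c : Euc m → ℝ} {u : Euc m}
    (hGi : IsInner (G u)) (hG : DifferentiableAt ℝ G u) (hbd : DifferentiableAt ℝ Gb u)
    (hc : DifferentiableAt ℝ c u) (hGb : ∀ᶠ y in 𝓝 u, Gb y = Real.exp (2 * c y) • G y) (v w : Euc m) :
    christoffel Gb u v w = christoffel G u v w + fderiv ℝ c u v • w + fderiv ℝ c u w • v
      - G u v w • sharp (G u) (fderiv ℝ c u) := by
  have hbi : IsInner (Gb u) := by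
    rw [hGb.self_of_nhds]; exact hGi.smul (Real.exp_pos _)
  have hder : ∀ a b d, fderiv ℝ Gb u a b d =
      Real.exp (2 * c u) * (fderiv ℝ G u a b d + 2 * fderiv ℝ c u a * G u b d) := by
    intro a b d
    have h1 : HasFDerivAt (fun y => Real.exp (2 * c y))
        (Real.exp (2 * c u) • (2 : ℝ) • fderiv ℝ c u) u := (hc.hasFDerivAt.const_mul 2).exp
    have h2 : (fun y => Gb y b d) =ᶠ[𝓝 u] fun y => Real.exp (2 * c y) * G y b d := by
      filter_upwards [hGb] with y hy
      rw [hy]; rfl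
    have h3 := (hG.hasFDerivAt.clm_apply (hasFDerivAt_const b u)).clm_apply (hasFDerivAt_const d u)
    have h4 := (hbd.hasFDerivAt.clm_apply (hasFDerivAt_const b u)).clm_apply (hasFDerivAt_const d u)
    have h5 := congrArg (fun L => L a) (h4.unique ((h1.mul h3).congr_of_eventuallyEq h2))
    simp only [add_apply, ContinuousLinearMap.comp_apply,
      ContinuousLinearMap.flip_apply, zero_apply, map_zero, zero_add,
      smul_apply, smul_eq_mul] at h5
    rw [h5]
    ring
  -- With the index lowered by `Gb`, both sides carry the factor e^{2c}, and its derivatives supply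
  -- the three correction terms.
  refine hbi.eq_of_forall fun z => ?_
  rw [hbi.christoffel_spec, hGb.self_of_nhds]
  have h3 := hGi.sharp_spec (fderiv ℝ c u : Euc m →ₗ[ℝ] ℝ) z
  simp only [ContinuousLinearMap.coe_coe] at h3
  simp only [smul_apply, map_add, map_sub, map_smul, add_apply, sub_apply, hGi.christoffel_spec,
    h3, smul_eq_mul, christoffelFirst, hder]
  ring

/-- The two rank-one corrections each trace to L(grad c), and the metric term to -m L(grad c). The
map `L` is left general to serve both df (tension field) and v ↦ ∇_v Y (rough Laplacian). -/
theorem metricTrace_map_christoffel_conformal {G Gb : Euc m → Bil m} {c : Euc m → ℝ} {u : Euc m}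
    (hGi : IsInner (G u)) (hG : DifferentiableAt ℝ G u) (hbd : DifferentiableAt ℝ Gb u)
    (hc : DifferentiableAt ℝ c u) (hGb : ∀ᶠ y in 𝓝 u, Gb y = Real.exp (2 * c y) • G y) (L : Euc m →ₗ[ℝ] Euc n) :
    metricTrace (G u) (fun v w => L (christoffel Gb u v w)) =
      metricTrace (G u) (fun v w => L (christoffel G u v w))
        - ((m : ℝ) - 2) • L (sharp (G u) (fderiv ℝ c u)) := by
  have h1 : ∀ v w, L (christoffel Gb u v w) = L (christoffel G u v w)
      + fderiv ℝ c u v • L w + fderiv ℝ c u w • L v - G u v w • L (sharp (G u) (fderiv ℝ c u)) := by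
    intro v w
    rw [christoffel_conformal hGi hG hbd hc hGb]
    simp only [map_add, map_sub, map_smul]
  rw [metricTrace_congr h1, metricTrace_sub, metricTrace_add, metricTrace_add,
    hGi.metricTrace_smul_left, metricTrace_smul_right, metricTrace_smul_const, hGi.scalarTrace_self]
  module

/-- The tension field under a conformal change of the metric of the domain. -/
theorem coordTension_conformal {G Gb : Euc m → Bil m} {H : Euc n → Bil n} {f : Euc m → Euc n}
    {c : Euc m → ℝ} {u : Euc m}
    (hGi : IsInner (G u)) (hG : DifferentiableAt ℝ G u) (hbd : DifferentiableAt ℝ Gb u)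
    (hc : DifferentiableAt ℝ c u) (hGb : ∀ᶠ y in 𝓝 u, Gb y = Real.exp (2 * c y) • G y) :
    coordTension Gb H f u = (Real.exp (2 * c u))⁻¹ •
      (coordTension G H f u + ((m : ℝ) - 2) • fderiv ℝ f u (sharp (G u) (fderiv ℝ c u))) := by
  have h1 := metricTrace_map_christoffel_conformal hGi hG hbd hc hGb (fderiv ℝ f u : Euc m →ₗ[ℝ] Euc n)
  simp only [ContinuousLinearMap.coe_coe] at h1
  unfold coordTension
  rw [hGb.self_of_nhds, metricTrace_smul_metric (Real.exp_ne_zero _)]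
  unfold coordHess
  rw [metricTrace_sub, metricTrace_sub, h1]
  module

/-- The rough Laplacian under a conformal change of the metric of the domain. -/
theorem metricTrace_coordSecondCovDeriv_conformal {G Gb : Euc m → Bil m} {H : Euc n → Bil n}
    {f Y : Euc m → Euc n} {c : Euc m → ℝ} {u : Euc m}
    (hGi : IsInner (G u)) (hG : DifferentiableAt ℝ G u) (hbd : DifferentiableAt ℝ Gb u)
    (hc : DifferentiableAt ℝ c u) (hGb : ∀ᶠ y in 𝓝 u, Gb y = Real.exp (2 * c y) • G y) :
    metricTrace (Gb u) (coordSecondCovDeriv Gb H f Y u) = (Real.exp (2 * c u))⁻¹ •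
      (metricTrace (G u) (coordSecondCovDeriv G H f Y u)
        + ((m : ℝ) - 2) • coordCovDeriv H f Y (sharp (G u) (fderiv ℝ c u)) u) := by
  have h1 := metricTrace_map_christoffel_conformal hGi hG hbd hc hGb (coordCovDerivLin H f Y u)
  simp only [coordCovDerivLin_apply] at h1
  rw [hGb.self_of_nhds, metricTrace_smul_metric (Real.exp_ne_zero _)]
  unfold coordSecondCovDeriv
  rw [metricTrace_sub, metricTrace_sub, h1]
  module

/-- The rough Laplacian of `e^{2c} Y`. -/
theorem metricTrace_coordSecondCovDeriv_exp_smul {G : Euc m → Bil m} {H : Euc n → Bil n}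
    {f Y : Euc m → Euc n} {c : Euc m → ℝ} {u : Euc m} (hGi : IsInner (G u))
    (hH : ContDiffAt ℝ ∞ H (f u)) (hi : IsInner (H (f u)))
    (hf : ContDiffAt ℝ ∞ f u) (hc : ContDiffAt ℝ ∞ c u) (hY : ContDiffAt ℝ ∞ Y u) :
    metricTrace (G u) (coordSecondCovDeriv G H f (fun y => Real.exp (2 * c y) • Y y) u) =
      Real.exp (2 * c u) • (metricTrace (G u) (coordSecondCovDeriv G H f Y u)
        + (4 : ℝ) • coordCovDeriv H f Y (sharp (G u) (fderiv ℝ c u)) u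
        + (2 * scalarTrace (G u) (fun v w => fderiv ℝ (fderiv ℝ c) u v w
            - fderiv ℝ c u (christoffel G u v w))
          + 4 * G u (sharp (G u) (fderiv ℝ c u)) (sharp (G u) (fderiv ℝ c u))) • Y u) := by
  set a : Euc m → ℝ := fun y => Real.exp (2 * c y) with ha
  have hac : ContDiffAt ℝ ∞ a u := (contDiffAt_const.mul hc).exp
  have hc1 := hc.differentiableAt (n := ∞) (by simp)
  have hc2 := hc.fderiv_infty.differentiableAt (n := ∞) (by simp)
  have hd : ∀ y, DifferentiableAt ℝ c y → HasFDerivAt a (a y • (2 : ℝ) • fderiv ℝ c y) y :=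
    fun y hy => (hy.hasFDerivAt.const_mul 2).exp
  have hd1 : fderiv ℝ a =ᶠ[𝓝 u] fun y => a y • (2 : ℝ) • fderiv ℝ c y := by
    filter_upwards [hc.eventually_differentiableAt] with y hy
    exact (hd y hy).fderiv
  have hd2 : ∀ v w, fderiv ℝ (fderiv ℝ a) u v w =
      a u * (2 * fderiv ℝ (fderiv ℝ c) u v w + 4 * (fderiv ℝ c u v * fderiv ℝ c u w)) := by
    intro v w
    rw [hd1.fderiv_eq, ((hd u hc1).fun_smul (hc2.hasFDerivAt.fun_const_smul (2 : ℝ))).fderiv]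
    simp
    ring
  -- Each first-order term is arranged as a functional of one argument times a linear map of the
  -- other, the form that the rank-one trace lemmas evaluate.
  have hpt : ∀ v w, coordSecondCovDeriv G H f (fun y => a y • Y y) u v w =
      a u • (coordSecondCovDeriv G H f Y u v w
        + ((2 : ℝ) • fderiv ℝ c u v • coordCovDerivLin H f Y u w
          + (2 : ℝ) • fderiv ℝ c u w • coordCovDerivLin H f Y u v)
        + ((2 : ℝ) • (fderiv ℝ (fderiv ℝ c) u v w - fderiv ℝ c u (christoffel G u v w)) • Y u
          + (4 : ℝ) • fderiv ℝ c u w • (fderiv ℝ c u v • Y u))) := by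
    intro v w
    rw [coordSecondCovDeriv_smul hH hi hf hac hY, hd2, hd1.self_of_nhds]
    simp only [smul_apply, smul_eq_mul, coordCovDerivLin_apply]
    module
  -- The term dc(w) dc(v) Y is rank-one too, with linear map v ↦ dc(v) Y; its trace dc(grad c) Y
  -- becomes |grad c|² Y through `hspec`.
  have hquad := metricTrace_smul_right (G u) (fderiv ℝ c u)
    ((fderiv ℝ c u : Euc m →ₗ[ℝ] ℝ).smulRight (Y u))
  simp only [LinearMap.smulRight_apply, ContinuousLinearMap.coe_coe] at hquad
  have hspec := hGi.sharp_spec (fderiv ℝ c u : Euc m →ₗ[ℝ] ℝ) (sharp (G u) (fderiv ℝ c u))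
  simp only [ContinuousLinearMap.coe_coe] at hspec
  rw [metricTrace_congr hpt]
  simp only [metricTrace_smul, metricTrace_add]
  rw [hGi.metricTrace_smul_left, metricTrace_smul_right, hquad, metricTrace_smul_const, hspec,
    coordCovDerivLin_apply]
  module

/-! ### Curvature -/

theorem coordCurvature_add {H : Euc n → Bil n} {q : Euc n} (hH : ContDiffAt ℝ ∞ H q)
    (hi : IsInner (H q)) (v w w' z : Euc n) :
    coordCurvature H q v (w + w') z = coordCurvature H q v w z + coordCurvature H q v w' z := by
  have hd : ∀ a b, DifferentiableAt ℝ (fun y => christoffel H y a b) q := fun a b =>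
    (contDiffAt_christoffel_const hH hi a b).differentiableAt (by simp)
  simp only [coordCurvature, christoffel_add_left, christoffel_add_right, map_add,
    fderiv_fun_add (hd w z) (hd w' z), add_apply]
  abel

theorem coordCurvature_smul {H : Euc n → Bil n} {q : Euc n} (hH : ContDiffAt ℝ ∞ H q)
    (hi : IsInner (H q)) (c : ℝ) (v w z : Euc n) :
    coordCurvature H q v (c • w) z = c • coordCurvature H q v w z := by
  have hd : DifferentiableAt ℝ (fun y => christoffel H y w z) q :=
    (contDiffAt_christoffel_const hH hi w z).differentiableAt (by simp)
  simp only [coordCurvature, christoffel_smul_left, christoffel_smul_right, map_smul,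
    fderiv_fun_const_smul hd c, smul_apply]
  module

end Calculus

/-! ### Passage between manifolds and charts. -/

section Charts

open Filter Topology

variable {m n k : ℕ}
  {M : Type*} [TopologicalSpace M] [ChartedSpace (EuclideanSpace ℝ (Fin m)) M]
  {N : Type*} [TopologicalSpace N] [ChartedSpace (EuclideanSpace ℝ (Fin n)) N]
  {P : Type*} [TopologicalSpace P] [ChartedSpace (EuclideanSpace ℝ (Fin k)) P]

/-! ### Tensors as functions into fixed vector spaces -/

/-- The value of a metric field as a bilinear form on the model space. -/
def bilAt (g : MetricField m M) (x : M) : Bil m := g x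

/-- The differential at `x` of the chart at `p`. -/
def toChart (p x : M) : Euc m →L[ℝ] Euc m := mfderiv (𝓡 m) 𝓘(ℝ, Euc m) (extChartAt (𝓡 m) p) x

/-- The differential at `u` of the inverse of the chart at `p`. -/
def ofChart (p : M) (u : Euc m) : Euc m →L[ℝ] Euc m := chartFrame p u

/-- The differential of a map as a linear map of model spaces. -/
def diffAt (φ : M → N) (x : M) : Euc m →L[ℝ] Euc n := differential φ x

/-- The coordinate expression of `φ` in the charts at `p` and `q`. -/
def mapInCharts (φ : M → N) (p : M) (q : N) (u : Euc m) : Euc n :=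
  extChartAt (𝓡 n) q (φ ((extChartAt (𝓡 m) p).symm u))

theorem coord_mem_target (p : M) : coord p ∈ (extChartAt (𝓡 m) p).target :=
  mem_extChartAt_target p

@[simp] theorem symm_coord (p : M) : (extChartAt (𝓡 m) p).symm (coord p) = p :=
  extChartAt_to_inv p

theorem metricInChart_eq (g : MetricField m M) (p : M) (u : Euc m) :
    metricInChart g p u =
      (bilAt g ((extChartAt (𝓡 m) p).symm u)).bilinearComp (ofChart p u) (ofChart p u) := rfl

theorem bilAt_pullbackMetric (h : MetricField n N) (φ : M → N) (x : M) :
    bilAt (pullbackMetric (m := m) h φ) x =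
      (bilAt h (φ x)).bilinearComp (diffAt (m := m) (n := n) φ x) (diffAt (m := m) (n := n) φ x) := rfl

theorem eventually_mem_target {p : M} {u : Euc m} (hu : u ∈ (extChartAt (𝓡 m) p).target) :
    ∀ᶠ y in 𝓝 u, y ∈ (extChartAt (𝓡 m) p).target :=
  (isOpen_extChartAt_target p).mem_nhds hu

/-- Tangent vectors at `p` are already coordinates in the preferred chart at `p`; hence coordinate
expressions at a chart centre agree with the intrinsic tensors. -/
theorem toChart_self [IsManifold (𝓡 m) ∞ M] (p : M) :
    toChart p p = ContinuousLinearMap.id ℝ (Euc m) := by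
  have : IsManifold (𝓡 m) 1 M := IsManifold.of_le (n := ∞) (by exact_mod_cast le_top)
  exact mfderiv_extChartAt_self (I := 𝓡 m) (x := p)

theorem ofChart_eq_mfderivWithin (p : M) (u : Euc m) :
    ofChart p u = mfderivWithin 𝓘(ℝ, Euc m) (𝓡 m) (extChartAt (𝓡 m) p).symm
      (Set.range (𝓡 m)) u := by
  rw [ModelWithCorners.range_eq_univ, mfderivWithin_univ]
  rfl

theorem ofChart_toChart [IsManifold (𝓡 m) ∞ M] {p : M} {u : Euc m}
    (hu : u ∈ (extChartAt (𝓡 m) p).target) (v : Euc m) :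
    ofChart p u (toChart p ((extChartAt (𝓡 m) p).symm u) v) = v := by
  have : IsManifold (𝓡 m) 1 M := IsManifold.of_le (n := ∞) (by exact_mod_cast le_top)
  rw [ofChart_eq_mfderivWithin]
  exact congrArg (fun L => L v) (mfderivWithin_extChartAt_symm_comp_mfderiv_extChartAt (I := 𝓡 m) hu)

theorem toChart_ofChart [IsManifold (𝓡 m) ∞ M] {p : M} {u : Euc m}
    (hu : u ∈ (extChartAt (𝓡 m) p).target) (v : Euc m) :
    toChart p ((extChartAt (𝓡 m) p).symm u) (ofChart p u v) = v := by
  have : IsManifold (𝓡 m) 1 M := IsManifold.of_le (n := ∞) (by exact_mod_cast le_top)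
  rw [ofChart_eq_mfderivWithin]
  exact congrArg (fun L => L v) (mfderiv_extChartAt_comp_mfderivWithin_extChartAt_symm (I := 𝓡 m) hu)

theorem ofChart_coord [IsManifold (𝓡 m) ∞ M] (p : M) :
    ofChart p (coord p) = ContinuousLinearMap.id ℝ (Euc m) := by
  ext1 v
  have := toChart_ofChart (coord_mem_target p) v
  rwa [symm_coord, toChart_self] at this

theorem ofChart_injective [IsManifold (𝓡 m) ∞ M] {p : M} {u : Euc m}
    (hu : u ∈ (extChartAt (𝓡 m) p).target) : Function.Injective (ofChart p u) :=
  Function.LeftInverse.injective (toChart_ofChart hu)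

theorem metricInChart_coord [IsManifold (𝓡 m) ∞ M] (g : MetricField m M) (p : M) :
    metricInChart g p (coord p) = bilAt g p := by
  rw [metricInChart_eq, ofChart_coord, symm_coord]
  rfl

/-! ### Maps in charts -/

theorem contDiffAt_mapInCharts [IsManifold (𝓡 m) ∞ M] [IsManifold (𝓡 n) ∞ N] {φ : M → N}
    (hφ : ContMDiff (𝓡 m) (𝓡 n) ∞ φ) {p : M} {q : N} {u : Euc m}
    (hu : u ∈ (extChartAt (𝓡 m) p).target)
    (hq : φ ((extChartAt (𝓡 m) p).symm u) ∈ (extChartAt (𝓡 n) q).source) :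
    ContDiffAt ℝ ∞ (mapInCharts (m := m) (n := n) φ p q) u := by
  rw [← contMDiffAt_iff_contDiffAt]
  have h1 : ContMDiffAt 𝓘(ℝ, Euc m) (𝓡 m) ∞ (extChartAt (𝓡 m) p).symm u :=
    (contMDiffOn_extChartAt_symm p).contMDiffAt (eventually_mem_target hu)
  have h2 : ContMDiffAt (𝓡 n) 𝓘(ℝ, Euc n) ∞ (extChartAt (𝓡 n) q)
      (φ ((extChartAt (𝓡 m) p).symm u)) :=
    contMDiffAt_extChartAt' (by simpa using hq)
  exact h2.comp u ((hφ _).comp u h1)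

theorem fderiv_mapInCharts [IsManifold (𝓡 m) ∞ M] [IsManifold (𝓡 n) ∞ N] {φ : M → N}
    (hφ : ContMDiff (𝓡 m) (𝓡 n) ∞ φ) {p : M} {q : N} {u : Euc m}
    (hu : u ∈ (extChartAt (𝓡 m) p).target)
    (hq : φ ((extChartAt (𝓡 m) p).symm u) ∈ (extChartAt (𝓡 n) q).source) :
    fderiv ℝ (mapInCharts (m := m) (n := n) φ p q) u =
      (toChart q (φ ((extChartAt (𝓡 m) p).symm u))).comp
        ((diffAt (m := m) (n := n) φ ((extChartAt (𝓡 m) p).symm u)).comp (ofChart p u)) := by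
  have h1 : ContMDiffAt 𝓘(ℝ, Euc m) (𝓡 m) ∞ (extChartAt (𝓡 m) p).symm u :=
    (contMDiffOn_extChartAt_symm p).contMDiffAt (eventually_mem_target hu)
  have h2 : ContMDiffAt (𝓡 n) 𝓘(ℝ, Euc n) ∞ (extChartAt (𝓡 n) q)
      (φ ((extChartAt (𝓡 m) p).symm u)) :=
    contMDiffAt_extChartAt' (by simpa using hq)
  have d1 := (h1.mdifferentiableAt (by simp)).hasMFDerivAt
  have d2 := (h2.mdifferentiableAt (by simp)).hasMFDerivAt
  have d3 := ((hφ ((extChartAt (𝓡 m) p).symm u)).mdifferentiableAt (by simp)).hasMFDerivAt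
  have d4 := HasMFDerivAt.comp u d2 (HasMFDerivAt.comp u d3 d1)
  have d5 : HasFDerivAt (mapInCharts (m := m) (n := n) φ p q)
      ((toChart q (φ ((extChartAt (𝓡 m) p).symm u))).comp
        ((diffAt (m := m) (n := n) φ ((extChartAt (𝓡 m) p).symm u)).comp (ofChart p u))) u :=
    hasMFDerivAt_iff_hasFDerivAt.1 d4
  exact d5.fderiv

theorem eventually_mapInCharts_mem [IsManifold (𝓡 m) ∞ M] {φ : M → N} (hφ : Continuous φ)
    {p : M} {q : N} {u : Euc m} (hu : u ∈ (extChartAt (𝓡 m) p).target)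
    (hq : φ ((extChartAt (𝓡 m) p).symm u) ∈ (extChartAt (𝓡 n) q).source) :
    ∀ᶠ y in 𝓝 u, φ ((extChartAt (𝓡 m) p).symm y) ∈ (extChartAt (𝓡 n) q).source := by
  have h1 : ContinuousAt (extChartAt (𝓡 m) p).symm u := continuousAt_extChartAt_symm'' hu
  have h2 : ContinuousAt (fun y => φ ((extChartAt (𝓡 m) p).symm y)) u :=
    hφ.continuousAt.comp h1
  exact h2.eventually ((isOpen_extChartAt_source q).mem_nhds hq)

theorem mapInCharts_comp {φ : M → N} {ψ : N → P} {p : M} {q : N} {r : P} {u : Euc m}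
    (hq : φ ((extChartAt (𝓡 m) p).symm u) ∈ (extChartAt (𝓡 n) q).source) :
    mapInCharts (m := n) (n := k) ψ q r (mapInCharts (m := m) (n := n) φ p q u) = mapInCharts (m := m) (n := k) (ψ ∘ φ) p r u := by
  simp only [mapInCharts, Function.comp_apply]
  rw [(extChartAt (𝓡 n) q).left_inv hq]

/-- The coordinate expression of a pulled back metric. -/
theorem metricInChart_pullbackMetric [IsManifold (𝓡 m) ∞ M] [IsManifold (𝓡 n) ∞ N] {φ : M → N}
    (hφ : ContMDiff (𝓡 m) (𝓡 n) ∞ φ) (h : MetricField n N) {p : M} {q : N} {u : Euc m}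
    (hu : u ∈ (extChartAt (𝓡 m) p).target)
    (hq : φ ((extChartAt (𝓡 m) p).symm u) ∈ (extChartAt (𝓡 n) q).source) :
    metricInChart (pullbackMetric (m := m) h φ) p u =
      (metricInChart h q (mapInCharts (m := m) (n := n) φ p q u)).bilinearComp
        (fderiv ℝ (mapInCharts (m := m) (n := n) φ p q) u) (fderiv ℝ (mapInCharts (m := m) (n := n) φ p q) u) := by
  have hinv : (extChartAt (𝓡 n) q).symm (mapInCharts (m := m) (n := n) φ p q u) =
      φ ((extChartAt (𝓡 m) p).symm u) := (extChartAt (𝓡 n) q).left_inv hq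
  have ht : mapInCharts (m := m) (n := n) φ p q u ∈ (extChartAt (𝓡 n) q).target :=
    (extChartAt (𝓡 n) q).map_source hq
  have hid := ofChart_toChart ht
  rw [hinv] at hid
  rw [metricInChart_eq, metricInChart_eq, bilAt_pullbackMetric, hinv, fderiv_mapInCharts hφ hu hq]
  ext v w
  simp only [ContinuousLinearMap.bilinearComp_apply, ContinuousLinearMap.comp_apply, hid]

theorem diffAt_id (x : M) : diffAt (m := m) (n := m) (id : M → M) x = ContinuousLinearMap.id ℝ (Euc m) :=
  mfderiv_id (I := 𝓡 m) (x := x)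

theorem pullbackMetric_id (g : MetricField m M) : pullbackMetric (m := m) g (id : M → M) = g := by
  funext x
  have h1 := bilAt_pullbackMetric (m := m) g (id : M → M) x
  rw [diffAt_id] at h1
  exact h1

theorem metricInChart_transition [IsManifold (𝓡 m) ∞ M] (g : MetricField m M) {p q : M} {u : Euc m}
    (hu : u ∈ (extChartAt (𝓡 m) p).target)
    (hq : (extChartAt (𝓡 m) p).symm u ∈ (extChartAt (𝓡 m) q).source) :
    metricInChart g p u = (metricInChart g q (mapInCharts (m := m) (n := m) id p q u)).bilinearComp
        (fderiv ℝ (mapInCharts (m := m) (n := m) id p q) u) (fderiv ℝ (mapInCharts (m := m) (n := m) id p q) u) := by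
  conv_lhs => rw [← pullbackMetric_id g]
  exact metricInChart_pullbackMetric contMDiff_id g hu hq

/-! ### Riemannian metrics -/

/-- A metric field that is a smooth Riemannian metric. -/
structure IsRiemannian (g : MetricField m M) : Prop where
  isInner : ∀ x, IsInner (bilAt g x)
  smooth : ∀ p, ∀ u ∈ (extChartAt (𝓡 m) p).target, ContDiffAt ℝ ∞ (metricInChart g p) u

theorem contDiffOn_bil {E : Type*} [NormedAddCommGroup E] [NormedSpace ℝ E] {G : E → Bil m}
    {s : Set E} (hG : ∀ v w, ContDiffOn ℝ ∞ (fun y => G y v w) s) : ContDiffOn ℝ ∞ G s :=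
  contDiffOn_clm_apply.2 fun v => contDiffOn_clm_apply.2 fun w => hG v w

/-- A smooth bundle metric evaluated on a smooth local frame is smooth; the frame of the tangent
trivialization at `p` is the coordinate frame. -/
theorem isRiemannian_inner [IsManifold (𝓡 m) ∞ M]
    (g : Bundle.ContMDiffRiemannianMetric (𝓡 m) ∞ (EuclideanSpace ℝ (Fin m))
      (fun x : M => TangentSpace (𝓡 m) x)) : IsRiemannian (m := m) (M := M) g.inner where
  isInner x := ⟨fun v w => g.symm x v w, fun v hv => g.pos x v hv⟩
  smooth p u hu := by
    -- The tangent bundle loses one order of smoothness, and `∞ + 1` is again `∞`.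
    have : IsManifold (𝓡 m) (∞ + 1) M := ‹IsManifold (𝓡 m) ∞ M›
    have : IsManifold (𝓡 m) 1 M := IsManifold.of_le (n := ∞) (by exact_mod_cast le_top)
    refine (contDiffOn_bil fun v w => ?_).contDiffAt (eventually_mem_target hu)
    intro y hy
    refine ContDiffAt.contDiffWithinAt ?_
    rw [← contMDiffAt_iff_contDiffAt]
    set x := (extChartAt (𝓡 m) p).symm y with hx
    have hxs : x ∈ (chartAt (Euc m) p).source := by
      rw [← extChartAt_source (𝓡 m)]; exact (extChartAt (𝓡 m) p).map_target hy
    set e := trivializationAt (Euc m) (TangentSpace (𝓡 m) : M → Type _) p with he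
    have hsec : ∀ v : Euc m, ContMDiffAt (𝓡 m) ((𝓡 m).prod 𝓘(ℝ, Euc m)) ∞
        (fun x => Bundle.TotalSpace.mk' (Euc m) (E := fun x : M => TangentSpace (𝓡 m) x) x
          (e.symmL ℝ x v)) x := by
      intro v
      have hsymm := (e.contMDiffOn_symm (IB := 𝓡 m) (n := ∞)).contMDiffAt
        (e.open_target.mem_nhds (e.mem_target.2 hxs : (x, v) ∈ e.target))
      have hpair : ContMDiffAt (𝓡 m) ((𝓡 m).prod 𝓘(ℝ, Euc m)) ∞ (fun x : M => (x, v)) x :=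
        contMDiffAt_id.prodMk contMDiffAt_const
      refine (hsymm.comp x hpair).congr_of_eventuallyEq ?_
      filter_upwards [e.open_baseSet.mem_nhds hxs] with z hz
      rw [e.symmL_apply hz]
      exact e.mk_symm hz v
    have h1 := (g.contMDiff x).clm_bundle_apply₂ (hsec v) (hsec w)
    have h2 : ContMDiffAt (𝓡 m) 𝓘(ℝ, ℝ) ∞
        (fun x => g.inner x (e.symmL ℝ x v) (e.symmL ℝ x w)) x := by
      have h4 := (Bundle.contMDiffAt_totalSpace.1 h1).2
      exact h4
    have h3 : ContMDiffAt 𝓘(ℝ, Euc m) (𝓡 m) ∞ (extChartAt (𝓡 m) p).symm y :=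
      (contMDiffOn_extChartAt_symm p).contMDiffAt (eventually_mem_target hy)
    refine (h2.comp y h3).congr_of_eventuallyEq ?_
    filter_upwards [eventually_mem_target hy] with z hz
    have hzs : (extChartAt (𝓡 m) p).symm z ∈ (chartAt (Euc m) p).source := by
      rw [← extChartAt_source (𝓡 m)]; exact (extChartAt (𝓡 m) p).map_target hz
    have h5 := TangentBundle.symmL_trivializationAt (I := 𝓡 m) hzs
    rw [(extChartAt (𝓡 m) p).right_inv hz, ← ofChart_eq_mfderivWithin] at h5
    rw [metricInChart_eq, ← h5]
    rfl

theorem IsRiemannian.isInner_metricInChart [IsManifold (𝓡 m) ∞ M] {g : MetricField m M}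
    (hg : IsRiemannian g) {p : M} {u : Euc m} (hu : u ∈ (extChartAt (𝓡 m) p).target) :
    IsInner (metricInChart g p u) :=
  (hg.isInner _).comp _ (ofChart_injective hu)

theorem IsRiemannian.pullback [IsManifold (𝓡 m) ∞ M] [IsManifold (𝓡 n) ∞ N] {h : MetricField n N}
    (hh : IsRiemannian h) {φ : M → N} (hφ : ContMDiff (𝓡 m) (𝓡 n) ∞ φ)
    (hi : ∀ x, Function.Injective (diffAt (m := m) (n := n) φ x)) :
    IsRiemannian (pullbackMetric (m := m) h φ) where
  isInner x := (hh.isInner _).comp _ (hi x)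
  smooth p u hu := by
    refine (contDiffOn_bil fun v w => fun y hy => ContDiffAt.contDiffWithinAt ?_).contDiffAt
      (eventually_mem_target hu)
    -- Away from the centre, the image may leave the chart at `φ p`, so the target chart is
    -- recentred at the image of `y`.
    set q := φ ((extChartAt (𝓡 m) p).symm y) with hqdef
    have hq : φ ((extChartAt (𝓡 m) p).symm y) ∈ (extChartAt (𝓡 n) q).source :=
      mem_extChartAt_source _
    set F := mapInCharts (m := m) (n := n) φ p q with hFdef
    have h1 : (fun y => metricInChart (pullbackMetric (m := m) h φ) p y v w) =ᶠ[𝓝 y] fun y =>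
        metricInChart h q (F y) (fderiv ℝ F y v) (fderiv ℝ F y w) := by
      filter_upwards [eventually_mem_target hy, eventually_mapInCharts_mem hφ.continuous hy hq]
        with z hz hz'
      rw [metricInChart_pullbackMetric hφ h hz hz']
      rfl
    refine ContDiffAt.congr_of_eventuallyEq ?_ h1
    have hF : ContDiffAt ℝ ∞ F y := contDiffAt_mapInCharts hφ hy hq
    have hH : ContDiffAt ℝ ∞ (fun y => metricInChart h q (F y)) y :=
      ContDiffAt.comp (g := metricInChart h q) y
        (hh.smooth q _ ((extChartAt (𝓡 n) q).map_source hq)) hF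
    exact (hH.clm_apply (hF.fderiv_infty.clm_apply contDiffAt_const)).clm_apply
      (hF.fderiv_infty.clm_apply contDiffAt_const)

end Charts

/-! ### Chart independence and smoothness of the tension field. -/

section Fields

open Filter Topology

variable {m n : ℕ}
  {M : Type*} [TopologicalSpace M] [ChartedSpace (EuclideanSpace ℝ (Fin m)) M]
  [IsManifold (𝓡 m) ∞ M]
  {N : Type*} [TopologicalSpace N] [ChartedSpace (EuclideanSpace ℝ (Fin n)) N]
  [IsManifold (𝓡 n) ∞ N]

/-! ### The tension field in an arbitrary chart -/

theorem coordHess_congr {G : Euc m → Bil m} {H : Euc n → Bil n} {f f' : Euc m → Euc n} {u : Euc m}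
    (hff' : f =ᶠ[𝓝 u] f') (v w : Euc m) : coordHess G H f u v w = coordHess G H f' u v w := by
  have h1 : (fun y => fderiv ℝ f y w) =ᶠ[𝓝 u] fun y => fderiv ℝ f' y w :=
    (hff'.fderiv (𝕜 := ℝ)).mono fun y hy => congrArg (fun L => L w) hy
  simp only [coordHess, coordCovDeriv, h1.fderiv_eq, hff'.fderiv_eq, hff'.eq_of_nhds]

theorem mapInCharts_self_coord (φ : M → N) (p : M) :
    mapInCharts (m := m) (n := n) φ p (φ p) (coord p) = coord (φ p) := by
  simp only [mapInCharts, symm_coord]; rfl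

theorem map_symm_coord_mem (φ : M → N) (p : M) :
    φ ((extChartAt (𝓡 m) p).symm (coord p)) ∈ (extChartAt (𝓡 n) (φ p)).source := by
  rw [symm_coord]; exact mem_extChartAt_source _

theorem contDiffAt_mapInCharts_coord {φ : M → N} (hφ : ContMDiff (𝓡 m) (𝓡 n) ∞ φ) (p : M) :
    ContDiffAt ℝ ∞ (mapInCharts (m := m) (n := n) φ p (φ p)) (coord p) :=
  contDiffAt_mapInCharts hφ (coord_mem_target p) (map_symm_coord_mem φ p)

theorem fderiv_mapInCharts_coord {φ : M → N} (hφ : ContMDiff (𝓡 m) (𝓡 n) ∞ φ) (p : M) :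
    fderiv ℝ (mapInCharts (m := m) (n := n) φ p (φ p)) (coord p) =
      diffAt (m := m) (n := n) φ p := by
  rw [fderiv_mapInCharts hφ (coord_mem_target p) (map_symm_coord_mem φ p),
    symm_coord, ofChart_coord, toChart_self]
  rfl

/-- The value of a field along a map as a vector of the model space. -/
def fieldAt {φ : M → N} (X : FieldAlong (n := n) φ) (x : M) : Euc n := X x

/-- The coordinate expression, in the charts at `p` and `φ p`, of a field along `φ`. -/
def fieldCoord (φ : M → N) (X : M → Euc n) (p : M) (u : Euc m) : Euc n :=
  toChart (φ p) (φ ((extChartAt (𝓡 m) p).symm u)) (X ((extChartAt (𝓡 m) p).symm u))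

theorem fieldCoord_coord (φ : M → N) (X : M → Euc n) (p : M) :
    fieldCoord (m := m) φ X p (coord p) = X p := by
  rw [fieldCoord, symm_coord, toChart_self]; rfl

theorem tension_eq (g : MetricField m M) (h : MetricField n N) (φ : M → N) (p : M) :
    fieldAt (tension g h φ) p = coordTension (metricInChart g p) (metricInChart h (φ p))
      (mapInCharts (m := m) (n := n) φ p (φ p)) (coord p) := by
  rw [coordTension, metricInChart_coord]; rfl

theorem contDiffAt_transition {p q : M} {u : Euc m} (hu : u ∈ (extChartAt (𝓡 m) p).target)
    (hq : (extChartAt (𝓡 m) p).symm u ∈ (extChartAt (𝓡 m) q).source) :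
    ContDiffAt ℝ ∞ (mapInCharts (m := m) (n := m) id p q) u :=
  contDiffAt_mapInCharts contMDiff_id hu hq

theorem fderiv_transition {p q : M} {u : Euc m} (hu : u ∈ (extChartAt (𝓡 m) p).target)
    (hq : (extChartAt (𝓡 m) p).symm u ∈ (extChartAt (𝓡 m) q).source) :
    fderiv ℝ (mapInCharts (m := m) (n := m) id p q) u =
      (toChart q ((extChartAt (𝓡 m) p).symm u)).comp (ofChart p u) := by
  rw [fderiv_mapInCharts contMDiff_id hu hq, diffAt_id]; rfl

theorem fderiv_transition_self {p : M} {u : Euc m} (hu : u ∈ (extChartAt (𝓡 m) p).target) :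
    fderiv ℝ (mapInCharts (m := m) (n := m) id p ((extChartAt (𝓡 m) p).symm u)) u =
      ofChart p u := by
  rw [fderiv_transition hu (mem_extChartAt_source _), toChart_self]; rfl

/-- Changes of charts are totally geodesic. -/
theorem coordHess_transition {g : MetricField m M} (hg : IsRiemannian g) {p : M} {u : Euc m}
    (hu : u ∈ (extChartAt (𝓡 m) p).target) (v w : Euc m) :
    coordHess (metricInChart g p) (metricInChart g ((extChartAt (𝓡 m) p).symm u))
      (mapInCharts (m := m) (n := m) id p ((extChartAt (𝓡 m) p).symm u)) u v w = 0 := by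
  set q := (extChartAt (𝓡 m) p).symm u with hqdef
  have hq : (extChartAt (𝓡 m) p).symm u ∈ (extChartAt (𝓡 m) q).source := mem_extChartAt_source _
  have ht : mapInCharts (m := m) (n := m) id p q u ∈ (extChartAt (𝓡 m) q).target :=
    (extChartAt (𝓡 m) q).map_source hq
  refine coordHess_isometry (contDiffAt_transition hu hq)
    ((hg.smooth p u hu).differentiableAt (by simp)) ((hg.smooth q _ ht).differentiableAt (by simp))
    (hg.isInner_metricInChart ht) (hg.isInner_metricInChart hu) ?_ ?_ v w
  · filter_upwards [eventually_mem_target hu,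
      eventually_mapInCharts_mem (φ := (id : M → M)) continuous_id hu hq] with y hy hy'
    exact metricInChart_transition g hy hy'
  · rw [fderiv_transition_self hu]
    exact Function.RightInverse.surjective (ofChart_toChart hu)

/-- The tension field is given by the coordinate formula in every chart. -/
theorem fieldCoord_tension {g : MetricField m M} {h : MetricField n N} (hg : IsRiemannian g)
    (hh : IsRiemannian h) {φ : M → N} (hφ : ContMDiff (𝓡 m) (𝓡 n) ∞ φ) {p : M} {u : Euc m}
    (hu : u ∈ (extChartAt (𝓡 m) p).target)
    (hq : φ ((extChartAt (𝓡 m) p).symm u) ∈ (extChartAt (𝓡 n) (φ p)).source) :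
    fieldCoord φ (fieldAt (tension g h φ)) p u = coordTension (metricInChart g p) (metricInChart h (φ p))
      (mapInCharts (m := m) (n := n) φ p (φ p)) u := by
  set q := (extChartAt (𝓡 m) p).symm u with hqdef
  set F := mapInCharts (m := m) (n := n) φ p (φ p) with hF
  set Fq := mapInCharts (m := m) (n := n) φ q (φ q) with hFq
  set a := mapInCharts (m := m) (n := m) id p q with ha
  set b := mapInCharts (m := n) (n := n) id (φ p) (φ q) with hb
  have hqs : (extChartAt (𝓡 m) p).symm u ∈ (extChartAt (𝓡 m) q).source := mem_extChartAt_source _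
  have hFu : F u ∈ (extChartAt (𝓡 n) (φ p)).target := (extChartAt (𝓡 n) (φ p)).map_source hq
  have hFsymm : (extChartAt (𝓡 n) (φ p)).symm (F u) = φ q :=
    (extChartAt (𝓡 n) (φ p)).left_inv hq
  have hFus : (extChartAt (𝓡 n) (φ p)).symm (F u) ∈ (extChartAt (𝓡 n) (φ q)).source := by
    rw [hFsymm]; exact mem_extChartAt_source _
  have hcF : ContDiffAt ℝ ∞ F u := contDiffAt_mapInCharts hφ hu hq
  have hcFq : ContDiffAt ℝ ∞ Fq (a u) := contDiffAt_mapInCharts_coord hφ q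
  have hca : ContDiffAt ℝ ∞ a u := contDiffAt_transition hu hqs
  have hcb : ContDiffAt ℝ ∞ b (F u) := contDiffAt_transition hFu hFus
  -- Two factorizations of one map: change the source chart first, or the target chart last.
  have hcomm : Fq ∘ a =ᶠ[𝓝 u] b ∘ F := by
    filter_upwards [eventually_mapInCharts_mem (φ := (id : M → M)) continuous_id hu hqs,
      eventually_mapInCharts_mem hφ.continuous hu hq] with y hy hy'
    exact (mapInCharts_comp (φ := (id : M → M)) (ψ := φ) hy).trans
      (mapInCharts_comp (φ := φ) (ψ := (id : N → N)) hy').symm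
  have hDa : fderiv ℝ a u = ofChart p u := fderiv_transition_self hu
  have hDb : fderiv ℝ b (F u) = ofChart (φ p) (F u) := by
    have := fderiv_transition_self hFu
    rwa [hFsymm] at this
  have hessa := coordHess_transition hg hu
  have hessb := coordHess_transition hh hFu
  rw [hFsymm] at hessb
  -- The composition formula is applied to both factorizations. The Hessians of `a` and `b` vanish,
  -- so one term survives on each side.
  have key : ∀ v w, coordHess (metricInChart g q) (metricInChart h (φ q)) Fq (a u)
      (ofChart p u v) (ofChart p u w) = ofChart (φ p) (F u)
        (coordHess (metricInChart g p) (metricInChart h (φ p)) F u v w) := by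
    intro v w
    have h1 := coordHess_comp (G := metricInChart g p) (H := metricInChart g q)
      (K := metricInChart h (φ q)) hca hcFq v w
    have h2 := coordHess_comp (G := metricInChart g p) (H := metricInChart h (φ p))
      (K := metricInChart h (φ q)) hcF hcb v w
    rw [hessa, map_zero, zero_add, hDa] at h1
    rw [hessb, add_zero, hDb] at h2
    rw [← h1, ← h2]
    exact coordHess_congr hcomm v w
  have hG : metricInChart g p u = (metricInChart g q (a u)).bilinearComp (ofChart p u)
      (ofChart p u) := by
    rw [metricInChart_transition g hu hqs, hDa]
  -- Trace `key`: invariance of the trace absorbs the source frame, and linearity pulls out the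
  -- target frame.
  have htrace : fieldAt (tension g h φ) q = ofChart (φ p) (F u) (coordTension (metricInChart g p)
      (metricInChart h (φ p)) F u) := by
    have hit : IsInner (metricInChart g q (a u)) := hg.isInner_metricInChart (coord_mem_target q)
    have h3 := hit.metricTrace_comp (ofChart p u) (ofChart_injective hu)
      (coordHessBilin (metricInChart g q) (metricInChart h (φ q)) Fq (a u))
    simp only [coordHessBilin_apply hcFq] at h3
    rw [← hG, metricTrace_congr key, metricTrace_map] at h3
    rw [tension_eq]
    exact h3.symm
  rw [fieldCoord, ← hqdef, htrace]
  have h4 := toChart_ofChart hFu (coordTension (metricInChart g p) (metricInChart h (φ p)) F u)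
  rwa [hFsymm] at h4

/-- A field along a map that is smooth at the centre of every preferred chart. -/
def IsSmoothField (φ : M → N) (X : M → Euc n) : Prop :=
  ∀ p : M, ContDiffAt ℝ ∞ (fieldCoord (m := m) φ X p) (coord p)

/-- Near a chart centre the pointwise-defined tension agrees with a single smooth coordinate
expression. This licenses the Leibniz rules applied to it later. -/
theorem isSmoothField_tension {g : MetricField m M} {h : MetricField n N} (hg : IsRiemannian g)
    (hh : IsRiemannian h) {φ : M → N} (hφ : ContMDiff (𝓡 m) (𝓡 n) ∞ φ) :
    IsSmoothField (m := m) (n := n) φ (fieldAt (tension g h φ)) := by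
  intro p
  have hu := coord_mem_target (m := m) p
  have hq := map_symm_coord_mem (m := m) (n := n) φ p
  have h1 : fieldCoord φ (fieldAt (tension g h φ)) p =ᶠ[𝓝 (coord p)] coordTension (metricInChart g p)
      (metricInChart h (φ p)) (mapInCharts (m := m) (n := n) φ p (φ p)) := by
    filter_upwards [eventually_mem_target hu, eventually_mapInCharts_mem hφ.continuous hu hq]
      with y hy hy'
    exact fieldCoord_tension hg hh hφ hy hy'
  have ht : mapInCharts (m := m) (n := n) φ p (φ p) (coord p) ∈ (extChartAt (𝓡 n) (φ p)).target :=
    (extChartAt (𝓡 n) (φ p)).map_source hq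
  exact (contDiffAt_coordTension (hg.smooth p _ hu) (hg.isInner_metricInChart hu)
    (hh.smooth _ _ ht) (hh.isInner_metricInChart ht)
    (contDiffAt_mapInCharts hφ hu hq)).congr_of_eventuallyEq h1

end Fields

/-! ### The Jacobi operator and the conformal comparison. -/

section Conformal

open Filter Topology

variable {m n : ℕ}
  {M : Type*} [TopologicalSpace M] [ChartedSpace (EuclideanSpace ℝ (Fin m)) M]
  [IsManifold (𝓡 m) ∞ M]
  {N : Type*} [TopologicalSpace N] [ChartedSpace (EuclideanSpace ℝ (Fin n)) N]
  [IsManifold (𝓡 n) ∞ N]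

/-! ### Operators on fields along a map -/

theorem fieldCoord_add (φ : M → N) (X Y : M → Euc n) (p : M) :
    fieldCoord (m := m) φ (fun x => X x + Y x) p =
      fun u => fieldCoord φ X p u + fieldCoord φ Y p u := by
  funext u; simp only [fieldCoord, map_add]

theorem fieldCoord_smul (φ : M → N) (a : M → ℝ) (X : M → Euc n) (p : M) :
    fieldCoord (m := m) φ (fun x => a x • X x) p =
      fun u => funInChart (m := m) a p u • fieldCoord φ X p u := by
  funext u; simp only [fieldCoord, map_smul, funInChart]

theorem IsSmoothField.add {φ : M → N} {X Y : M → Euc n} (hX : IsSmoothField (m := m) φ X)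
    (hY : IsSmoothField (m := m) φ Y) : IsSmoothField (m := m) φ (fun x => X x + Y x) := by
  intro p
  rw [fieldCoord_add]
  exact (hX p).add (hY p)

theorem contDiffAt_funInChart {a : M → ℝ} (ha : ContMDiff (𝓡 m) 𝓘(ℝ, ℝ) ∞ a) (p : M) :
    ContDiffAt ℝ ∞ (funInChart (m := m) a p) (coord p) := by
  rw [← contMDiffAt_iff_contDiffAt]
  have h1 : ContMDiffAt 𝓘(ℝ, Euc m) (𝓡 m) ∞ (extChartAt (𝓡 m) p).symm (coord p) :=
    (contMDiffOn_extChartAt_symm p).contMDiffAt (eventually_mem_target (coord_mem_target p))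
  exact (ha _).comp _ h1

theorem IsSmoothField.smul {φ : M → N} {a : M → ℝ} {X : M → Euc n}
    (ha : ContMDiff (𝓡 m) 𝓘(ℝ, ℝ) ∞ a) (hX : IsSmoothField (m := m) φ X) :
    IsSmoothField (m := m) φ (fun x => a x • X x) := by
  intro p
  rw [fieldCoord_smul]
  exact (contDiffAt_funInChart ha p).smul (hX p)

/-- `∇^φ_v X` for a field with values in the model space. -/
def covDerivAt (h : MetricField n N) (φ : M → N) (X : M → Euc n) (p : M) (v : Euc m) : Euc n :=
  coordCovDeriv (metricInChart h (φ p)) (mapInCharts (m := m) (n := n) φ p (φ p))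
    (fieldCoord φ X p) v (coord p)

/-- The rough Laplacian of a field with values in the model space. -/
def roughLaplacianAt (g : MetricField m M) (h : MetricField n N) (φ : M → N) (X : M → Euc n)
    (p : M) : Euc n :=
  metricTrace (metricInChart g p (coord p))
    (coordSecondCovDeriv (metricInChart g p) (metricInChart h (φ p))
      (mapInCharts (m := m) (n := n) φ p (φ p)) (fieldCoord φ X p) (coord p))

/-- The curvature trace of a field with values in the model space. -/
def curvatureTraceAt (g : MetricField m M) (h : MetricField n N) (φ : M → N) (X : M → Euc n)
    (p : M) : Euc n :=
  metricTrace (metricInChart g p (coord p)) fun v w =>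
    coordCurvature (metricInChart h (φ p)) (coord (φ p)) (diffAt (m := m) (n := n) φ p v) (X p)
      (diffAt (m := m) (n := n) φ p w)

/-- The negative of the Jacobi operator. -/
def negJacobi (g : MetricField m M) (h : MetricField n N) (φ : M → N) (X : M → Euc n)
    (p : M) : Euc n :=
  roughLaplacianAt g h φ X p - curvatureTraceAt g h φ X p

theorem bitension_eq (g : MetricField m M) (h : MetricField n N) (φ : M → N) (p : M) :
    fieldAt (bitension g h φ) p = negJacobi g h φ (fieldAt (tension g h φ)) p := by
  rw [negJacobi, roughLaplacianAt, curvatureTraceAt, metricInChart_coord]; rfl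

theorem jacobi_eq (g : MetricField m M) (h : MetricField n N) (φ : M → N)
    (X : FieldAlong (n := n) φ) (p : M) :
    fieldAt (jacobi g h X) p = -negJacobi g h φ (fieldAt X) p := by
  rw [negJacobi, roughLaplacianAt, curvatureTraceAt, metricInChart_coord]; rfl

theorem covDerivAt_const_smul {h : MetricField n N} {φ : M → N} {X : M → Euc n} (hX : IsSmoothField (m := m) φ X) (c : ℝ) (p : M)
    (v : Euc m) : covDerivAt h φ (fun x => c • X x) p v = c • covDerivAt h φ X p v := by
  have h1 := coordCovDeriv_smul (H := metricInChart h (φ p))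
    (f := mapInCharts (m := m) (n := n) φ p (φ p)) (differentiableAt_const c)
    ((hX p).differentiableAt (by simp)) v
  rw [covDerivAt, fieldCoord_smul]
  refine h1.trans ?_
  simp [covDerivAt]

theorem IsRiemannian.contDiffAt_mapInCharts {h : MetricField n N} (hh : IsRiemannian h)
    (φ : M → N) (p : M) : ContDiffAt ℝ ∞ (metricInChart h (φ p))
      (mapInCharts (m := m) (n := n) φ p (φ p) (coord p)) := by
  rw [mapInCharts_self_coord]
  exact hh.smooth _ _ (coord_mem_target _)

theorem IsRiemannian.isInner_mapInCharts {h : MetricField n N} (hh : IsRiemannian h)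
    (φ : M → N) (p : M) : IsInner (metricInChart h (φ p)
      (mapInCharts (m := m) (n := n) φ p (φ p) (coord p))) := by
  rw [mapInCharts_self_coord]
  exact hh.isInner_metricInChart (coord_mem_target _)

theorem curvatureTraceAt_add {g : MetricField m M} {h : MetricField n N} (hh : IsRiemannian h)
    (φ : M → N) (X Y : M → Euc n) (p : M) :
    curvatureTraceAt g h φ (fun x => X x + Y x) p =
      curvatureTraceAt g h φ X p + curvatureTraceAt g h φ Y p := by
  have hq := coord_mem_target (m := n) (φ p)
  simp only [curvatureTraceAt]
  rw [← metricTrace_add]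
  exact metricTrace_congr fun v w =>
    coordCurvature_add (hh.smooth _ _ hq) (hh.isInner_metricInChart hq) _ _ _ _

/-- Curvature sees only the value of the field at `p`, so homogeneity under constants already
handles a function `a`. -/
theorem curvatureTraceAt_smul {g : MetricField m M} {h : MetricField n N} (hh : IsRiemannian h)
    (φ : M → N) (a : M → ℝ) (X : M → Euc n) (p : M) :
    curvatureTraceAt g h φ (fun x => a x • X x) p = a p • curvatureTraceAt g h φ X p := by
  have hq := coord_mem_target (m := n) (φ p)
  simp only [curvatureTraceAt]
  rw [← metricTrace_smul]
  exact metricTrace_congr fun v w =>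
    coordCurvature_smul (hh.smooth _ _ hq) (hh.isInner_metricInChart hq) _ _ _ _

theorem negJacobi_add {g : MetricField m M} {h : MetricField n N} {φ : M → N}
    (hh : IsRiemannian h) (hφ : ContMDiff (𝓡 m) (𝓡 n) ∞ φ) {X Y : M → Euc n}
    (hX : IsSmoothField (m := m) φ X) (hY : IsSmoothField (m := m) φ Y) (p : M) :
    negJacobi g h φ (fun x => X x + Y x) p = negJacobi g h φ X p + negJacobi g h φ Y p := by
  have h1 : roughLaplacianAt g h φ (fun x => X x + Y x) p =
      roughLaplacianAt g h φ X p + roughLaplacianAt g h φ Y p := by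
    simp only [roughLaplacianAt]
    rw [← metricTrace_add, fieldCoord_add]
    exact metricTrace_congr fun v w => coordSecondCovDeriv_add (hh.contDiffAt_mapInCharts φ p)
      (hh.isInner_mapInCharts φ p) (contDiffAt_mapInCharts_coord hφ p) (hX p) (hY p) v w
  rw [negJacobi, h1, curvatureTraceAt_add hh, negJacobi, negJacobi]
  abel

theorem negJacobi_const_smul {g : MetricField m M} {h : MetricField n N} {φ : M → N}
    (hh : IsRiemannian h) (hφ : ContMDiff (𝓡 m) (𝓡 n) ∞ φ) {X : M → Euc n}
    (hX : IsSmoothField (m := m) φ X) (c : ℝ) (p : M) :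
    negJacobi g h φ (fun x => c • X x) p = c • negJacobi g h φ X p := by
  have h1 : roughLaplacianAt g h φ (fun x => c • X x) p = c • roughLaplacianAt g h φ X p := by
    simp only [roughLaplacianAt]
    rw [← metricTrace_smul, fieldCoord_smul]
    refine metricTrace_congr fun v w => ?_
    refine (coordSecondCovDeriv_smul (a := fun _ => c) (hh.contDiffAt_mapInCharts φ p)
      (hh.isInner_mapInCharts φ p) (contDiffAt_mapInCharts_coord hφ p) contDiffAt_const (hX p)
      v w).trans ?_
    simp
  rw [negJacobi, h1, curvatureTraceAt_smul hh φ (fun _ => c), negJacobi, smul_sub]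

/-- Homogeneity, with smoothness needed for the multiple only. -/
theorem negJacobi_const_smul_of_smul {g : MetricField m M} {h : MetricField n N} {φ : M → N}
    (hh : IsRiemannian h) (hφ : ContMDiff (𝓡 m) (𝓡 n) ∞ φ) {X : M → Euc n} {c : ℝ}
    (hX : IsSmoothField (m := m) φ (fun x => c • X x)) (p : M) :
    negJacobi g h φ (fun x => c • X x) p = c • negJacobi g h φ X p := by
  -- When `c` is nonzero, rescaling by `c⁻¹` recovers `X`. When it is zero, nothing is known about
  -- `X`, but both sides vanish; this covers the factor m - 2 in dimension two.
  rcases eq_or_ne c 0 with rfl | hc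
  · have h1 := negJacobi_const_smul (g := g) hh hφ hX 0 p
    simpa using h1
  · have h1 := negJacobi_const_smul (g := g) hh hφ hX c⁻¹ p
    simp only [smul_smul, inv_mul_cancel₀ hc, one_smul] at h1
    rw [h1, smul_smul, mul_inv_cancel₀ hc, one_smul]

/-! ### Conformal immersions -/

/-- The gradient as a vector of the model space. -/
def gradAt (g : MetricField m M) (f : M → ℝ) (p : M) : Euc m := grad g f p

theorem gradAt_eq (g : MetricField m M) {f : M → ℝ} (hf : ContMDiff (𝓡 m) 𝓘(ℝ, ℝ) ∞ f) (p : M) :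
    gradAt g f p = sharp (metricInChart g p (coord p))
      (fderiv ℝ (funInChart (m := m) f p) (coord p)) := by
  have h1 : MDifferentiableAt (𝓡 m) 𝓘(ℝ, ℝ) f p := (hf p).mdifferentiableAt (by simp)
  let L : Euc m →L[ℝ] ℝ := mfderiv (𝓡 m) 𝓘(ℝ, ℝ) f p
  have h2 : HasFDerivWithinAt (funInChart (m := m) f p) L (Set.range (𝓡 m)) (coord p) :=
    h1.hasMFDerivAt.2
  rw [ModelWithCorners.range_eq_univ, hasFDerivWithinAt_univ] at h2
  rw [h2.fderiv, metricInChart_coord]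
  rfl

theorem laplacian_eq (g : MetricField m M) (f : M → ℝ) (p : M) :
    laplacian g f p = scalarTrace (metricInChart g p (coord p)) fun v w =>
      fderiv ℝ (fderiv ℝ (funInChart (m := m) f p)) (coord p) v w
        - fderiv ℝ (funInChart (m := m) f p) (coord p)
            (christoffel (metricInChart g p) (coord p) v w) := by
  rw [metricInChart_coord]; rfl

/-- The tension field of an isometric immersion is `m` times the mean curvature vector. -/
theorem meanCurvatureVector_eq {h : MetricField n N} (hh : IsRiemannian h) {φ : M → N}
    (hφ : ContMDiff (𝓡 m) (𝓡 n) ∞ φ)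
    (hi : ∀ x, Function.Injective (diffAt (m := m) (n := n) φ x)) (p : M) :
    fieldAt (meanCurvatureVector (m := m) h φ) p =
      (1 / (m : ℝ)) • fieldAt (tension (pullbackMetric (m := m) h φ) h φ) p := by
  set gb := pullbackMetric (m := m) h φ with hgb
  have hg : IsRiemannian gb := hh.pullback hφ hi
  have hu := coord_mem_target (m := m) p
  set F := mapInCharts (m := m) (n := n) φ p (φ p) with hF
  have hcF : ContDiffAt ℝ ∞ F (coord p) := contDiffAt_mapInCharts_coord hφ p
  have hDF : fderiv ℝ F (coord p) = diffAt (m := m) (n := n) φ p := fderiv_mapInCharts_coord hφ p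
  have hH0 : metricInChart h (φ p) (F (coord p)) = bilAt h (φ p) := by
    rw [hF, mapInCharts_self_coord, metricInChart_coord]
  have hiso : ∀ᶠ y in 𝓝 (coord p), metricInChart gb p y =
      (metricInChart h (φ p) (F y)).bilinearComp (fderiv ℝ F y) (fderiv ℝ F y) := by
    filter_upwards [eventually_mem_target hu,
      eventually_mapInCharts_mem hφ.continuous hu
        (map_symm_coord_mem (m := m) (n := n) φ p)] with y hy hy'
    exact metricInChart_pullbackMetric hφ h hy hy'
  have hnormal := coordHess_normal hcF ((hg.smooth p _ hu).differentiableAt (by simp))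
    ((hh.contDiffAt_mapInCharts φ p).differentiableAt (by simp)) (hh.isInner_mapInCharts φ p)
    (hg.isInner_metricInChart hu) hiso
  have hB : ∀ v w : Euc m, (secondFundamentalForm (m := m) h φ p v w : Euc n) =
      coordHess (metricInChart gb p) (metricInChart h (φ p)) F (coord p) v w := by
    intro v w
    set D : Euc n := coordCovDeriv (metricInChart h (φ p)) F (fun u => fderiv ℝ F u w) v (coord p)
      with hD
    set Γ : Euc m := christoffel (metricInChart gb p) (coord p) v w with hΓ
    -- Normality of D - dφ(Γ) says that `Γ` represents z ↦ h(D, dφ z). Thus the tangential part of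
    -- `D` is dφ(Γ), and the second fundamental form is the Hessian.
    have h1 : sharp (bilAt gb p) (fun z => bilAt h (φ p) D (diffAt (m := m) (n := n) φ p z)) = Γ := by
      refine (hg.isInner p).sharp_unique
        (((bilAt h (φ p) D).comp (diffAt (m := m) (n := n) φ p) : Euc m →L[ℝ] ℝ) :
          Euc m →ₗ[ℝ] ℝ) fun z => ?_
      have h2 := hnormal v w z
      rw [coordHess, ← hD, ← hΓ, hH0, hDF, map_sub, sub_apply, sub_eq_zero] at h2
      rw [hgb, bilAt_pullbackMetric]
      exact h2.symm
    have h3 : (secondFundamentalForm (m := m) h φ p v w : Euc n) = D - diffAt (m := m) (n := n) φ p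
      (sharp (bilAt gb p) (fun z => bilAt h (φ p) D (diffAt (m := m) (n := n) φ p z))) := rfl
    rw [h3, h1, coordHess, ← hD, ← hΓ, hDF]
  rw [tension_eq, coordTension, metricInChart_coord, ← metricTrace_congr hB]
  rfl

/-- The bitension fields of a conformal immersion with respect to conformal metrics. -/
theorem bitension_conformal {g : MetricField m M} {h : MetricField n N} (hg : IsRiemannian g)
    (hh : IsRiemannian h) {φ : M → N} {lam : M → ℝ} (hc : IsConformalImmersion g h φ lam) (p : M) :
    fieldAt (bitension g h φ) p =
      lam p ^ 4 • fieldAt (bitension (pullbackMetric (m := m) h φ) h φ) p -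
        (-(((m : ℝ) - 2) • -negJacobi g h φ
              (fun x => diffAt (m := m) (n := n) φ x (gradAt g (fun x => Real.log (lam x)) x)) p)
          + (2 * (m : ℝ) * lam p ^ 2 *
              (-laplacian g (fun x => Real.log (lam x)) p
                - 2 * bilAt g p (gradAt g (fun x => Real.log (lam x)) p)
                  (gradAt g (fun x => Real.log (lam x)) p))) •
              fieldAt (meanCurvatureVector (m := m) h φ) p
          + ((m : ℝ) * ((m : ℝ) - 6) * lam p ^ 2) •
              covDerivAt h φ (fieldAt (meanCurvatureVector (m := m) h φ)) p
                (gradAt g (fun x => Real.log (lam x)) p)) := by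
  set ℓ : M → ℝ := fun x => Real.log (lam x) with hℓ
  set gb := pullbackMetric (m := m) h φ with hgb
  have hφ := hc.smooth
  have hi : ∀ x, Function.Injective (diffAt (m := m) (n := n) φ x) := hc.immersion
  have hgbR : IsRiemannian gb := hh.pullback hφ hi
  have hℓs : ContMDiff (𝓡 m) 𝓘(ℝ, ℝ) ∞ ℓ := fun x =>
    ((Real.contDiffAt_log.2 (hc.factor_pos x).ne').contMDiffAt (n := ∞)).comp x (hc.smooth_factor x)
  have hexp : ∀ x, Real.exp (2 * ℓ x) = lam x ^ 2 := fun x => by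
    rw [two_mul, Real.exp_add, Real.exp_log (hc.factor_pos x), sq]
  have hlam2 : ContMDiff (𝓡 m) 𝓘(ℝ, ℝ) ∞ (fun x => lam x ^ 2) := hc.smooth_factor.pow 2
  have hGb : ∀ q : M, ∀ᶠ y in 𝓝 (coord (m := m) q), metricInChart gb q y =
      Real.exp (2 * funInChart (m := m) ℓ q y) • metricInChart g q y := fun q =>
    Eventually.of_forall fun y => by
      have h1 : bilAt gb ((extChartAt (𝓡 m) q).symm y) =
          lam ((extChartAt (𝓡 m) q).symm y) ^ 2 • bilAt g ((extChartAt (𝓡 m) q).symm y) :=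
        hc.pullback_eq _
      rw [metricInChart_eq, h1, funInChart, hexp]
      rfl
  set T : M → Euc n := fieldAt (tension gb h φ) with hT
  set S : M → Euc n := fieldAt (tension g h φ) with hS
  set W : M → Euc n := fun x => diffAt (m := m) (n := n) φ x (gradAt g ℓ x) with hW
  have hTs : IsSmoothField (m := m) φ T := isSmoothField_tension hgbR hh hφ
  have hSs : IsSmoothField (m := m) φ S := isSmoothField_tension hg hh hφ
  have hE : fieldAt (meanCurvatureVector (m := m) h φ) = fun x => (1 / (m : ℝ)) • T x :=
    funext fun x => meanCurvatureVector_eq hh hφ hi x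
  -- The conformal tension formula solved for `S`; it is needed at every point because the Jacobi
  -- operator differentiates it.
  have hSeq : ∀ q, S q = lam q ^ 2 • T q + (-((m : ℝ) - 2)) • W q := by
    intro q
    have hu := coord_mem_target (m := m) q
    have h1 := coordTension_conformal (H := metricInChart h (φ q))
      (f := mapInCharts (m := m) (n := n) φ q (φ q)) (hg.isInner_metricInChart hu)
      ((hg.smooth q _ hu).differentiableAt (by simp))
      ((hgbR.smooth q _ hu).differentiableAt (by simp))
      ((contDiffAt_funInChart hℓs q).differentiableAt (by simp)) (hGb q)
    rw [← tension_eq, ← tension_eq, ← gradAt_eq g hℓs, fderiv_mapInCharts_coord hφ, funInChart,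
      symm_coord, hexp] at h1
    have h2 : T q = (lam q ^ 2)⁻¹ • (S q + ((m : ℝ) - 2) • W q) := h1
    have h3 : lam q ^ 2 ≠ 0 := pow_ne_zero _ (hc.factor_pos q).ne'
    rw [h2, smul_smul, mul_inv_cancel₀ h3]
    module
  have hX1 : IsSmoothField (m := m) φ (fun x => lam x ^ 2 • T x) := hTs.smul hlam2
  -- Smoothness of this multiple of `W` comes for free from that of `S` and λ² T, without
  -- differentiating the gradient in charts.
  have hX2 : IsSmoothField (m := m) φ (fun x => (-((m : ℝ) - 2)) • W x) := by
    have h1 : (fun x => (-((m : ℝ) - 2)) • W x) = fun x => S x + (-1 : ℝ) • (lam x ^ 2 • T x) := by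
      funext x; rw [hSeq]; module
    rw [h1]
    exact hSs.add (hX1.smul (a := fun _ => (-1 : ℝ)) contMDiff_const)
  have hu := coord_mem_target (m := m) p
  set V : Euc m := gradAt g ℓ p with hV
  have hVeq := gradAt_eq g hℓs p
  have hbit : fieldAt (bitension g h φ) p = negJacobi g h φ (fun x => lam x ^ 2 • T x) p
      + (-((m : ℝ) - 2)) • negJacobi g h φ W p := by
    rw [bitension_eq, ← negJacobi_const_smul_of_smul hh hφ hX2, ← negJacobi_add hh hφ hX1 hX2]
    congr 1
    exact funext hSeq
  have hrough : roughLaplacianAt g h φ (fun x => lam x ^ 2 • T x) p = lam p ^ 2 •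
      (roughLaplacianAt g h φ T p + (4 : ℝ) • covDerivAt h φ T p V
        + (2 * laplacian g ℓ p + 4 * bilAt g p V V) • T p) := by
    have h1 := metricTrace_coordSecondCovDeriv_exp_smul (hg.isInner_metricInChart hu)
      (hh.contDiffAt_mapInCharts φ p) (hh.isInner_mapInCharts φ p)
      (contDiffAt_mapInCharts_coord hφ p) (contDiffAt_funInChart hℓs p) (hTs p)
    rw [← hVeq, ← laplacian_eq, fieldCoord_coord, metricInChart_coord] at h1
    have h2 : funInChart (m := m) (fun x => lam x ^ 2) p =
        fun y => Real.exp (2 * funInChart (m := m) ℓ p y) := funext fun y => (hexp _).symm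
    have h3 : Real.exp (2 * funInChart (m := m) ℓ p (coord p)) = lam p ^ 2 := by
      rw [funInChart, symm_coord, hexp]
    rw [roughLaplacianAt, fieldCoord_smul, metricInChart_coord, h2, h1, h3, roughLaplacianAt,
      metricInChart_coord, covDerivAt]
  have hroughb : roughLaplacianAt gb h φ T p = (lam p ^ 2)⁻¹ •
      (roughLaplacianAt g h φ T p + ((m : ℝ) - 2) • covDerivAt h φ T p V) := by
    have h1 := metricTrace_coordSecondCovDeriv_conformal (H := metricInChart h (φ p))
      (f := mapInCharts (m := m) (n := n) φ p (φ p)) (Y := fieldCoord φ T p)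
      (hg.isInner_metricInChart hu)
      ((hg.smooth p _ hu).differentiableAt (by simp))
      ((hgbR.smooth p _ hu).differentiableAt (by simp))
      ((contDiffAt_funInChart hℓs p).differentiableAt (by simp)) (hGb p)
    rw [← hVeq, funInChart, symm_coord, hexp] at h1
    exact h1
  have hcurvb : curvatureTraceAt gb h φ T p = (lam p ^ 2)⁻¹ • curvatureTraceAt g h φ T p := by
    have h1 := (hGb p).self_of_nhds
    rw [funInChart, symm_coord, hexp] at h1
    rw [curvatureTraceAt, h1, metricTrace_smul_metric (pow_ne_zero _ (hc.factor_pos p).ne')]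
    rfl
  have hcov : covDerivAt h φ (fieldAt (meanCurvatureVector (m := m) h φ)) p V =
      (1 / (m : ℝ)) • covDerivAt h φ T p V := by
    rw [hE]; exact covDerivAt_const_smul hTs _ p V
  have hbitb : lam p ^ 4 • fieldAt (bitension gb h φ) p = lam p ^ 2 •
      (roughLaplacianAt g h φ T p + ((m : ℝ) - 2) • covDerivAt h φ T p V
        - curvatureTraceAt g h φ T p) := by
    rw [bitension_eq, negJacobi, hroughb, hcurvb, ← smul_sub, smul_smul]
    congr 1
    have := (hc.factor_pos p).ne'
    field_simp
  -- For m = 0 the factor 1/m is zero by convention, but then `T` is an empty trace. In `hcancelD`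
  -- the direction `V` vanishes instead.
  have hcancelT : (m : ℝ) • (1 / (m : ℝ)) • T p = T p := by
    rcases Nat.eq_zero_or_pos m with hm | hm
    · have : IsEmpty (Fin m) := by rw [hm]; infer_instance
      have hT0 : T p = 0 := by
        rw [hT, tension_eq, coordTension]; simp [metricTrace]
      rw [hT0]; simp
    · rw [smul_smul, mul_one_div_cancel (by exact_mod_cast hm.ne'), one_smul]
  have hcancelD : (m : ℝ) • (1 / (m : ℝ)) • covDerivAt h φ T p V = covDerivAt h φ T p V := by
    rcases Nat.eq_zero_or_pos m with hm | hm
    · have : IsEmpty (Fin m) := by rw [hm]; infer_instance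
      have hV0 : V = 0 := by ext i; exact isEmptyElim i
      have hD0 : covDerivAt h φ T p V = 0 := by
        rw [hV0]; exact map_zero (coordCovDerivLin _ _ _ _)
      rw [hD0]; simp
    · rw [smul_smul, mul_one_div_cancel (by exact_mod_cast hm.ne'), one_smul]
  have e1 : (2 * (m : ℝ) * lam p ^ 2 * (-laplacian g ℓ p - 2 * bilAt g p V V)) •
      (1 / (m : ℝ)) • T p = (2 * lam p ^ 2 * (-laplacian g ℓ p - 2 * bilAt g p V V)) • T p := by
    conv_rhs => rw [← hcancelT, smul_smul]
    congr 1; ring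
  have e2 : ((m : ℝ) * ((m : ℝ) - 6) * lam p ^ 2) • (1 / (m : ℝ)) • covDerivAt h φ T p V =
      (((m : ℝ) - 6) * lam p ^ 2) • covDerivAt h φ T p V := by
    conv_rhs => rw [← hcancelD, smul_smul]
    congr 1; ring
  rw [hbit, hbitb, negJacobi, hrough, curvatureTraceAt_smul hh φ (fun x => lam x ^ 2), hcov, e2, hE,
    e1]
  -- Comparison of coefficients: 4 - (m - 2) = -(m - 6) on ∇_V T, and 2 Δc + 4 |V|² on T.
  module

end Conformal

end RiemannianMaps

end

theorem mainTheorem5 {m n : ℕ}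
    {M : Type*} [TopologicalSpace M] [ChartedSpace (EuclideanSpace ℝ (Fin m)) M]
    [IsManifold (𝓡 m) ∞ M]
    {N : Type*} [TopologicalSpace N] [ChartedSpace (EuclideanSpace ℝ (Fin n)) N]
    [IsManifold (𝓡 n) ∞ N]
    (g : Bundle.ContMDiffRiemannianMetric (𝓡 m) ∞ (EuclideanSpace ℝ (Fin m))
      (fun x : M => TangentSpace (𝓡 m) x))
    (h : Bundle.ContMDiffRiemannianMetric (𝓡 n) ∞ (EuclideanSpace ℝ (Fin n))
      (fun y : N => TangentSpace (𝓡 n) y))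
    (φ : M → N) (lam : M → ℝ) (hφ : IsConformalImmersion g.inner h.inner φ lam) :
    IsBiharmonic g.inner h.inner φ ↔
      ∀ p : M,
        let logLam : M → ℝ := fun x => Real.log (lam x)
        let V : ∀ x : M, TangentSpace (𝓡 m) x := grad g.inner logLam
        let η : FieldAlong (n := n) φ := meanCurvatureVector (m := m) h.inner φ
        lam p ^ 4 • bitension (pullbackMetric (m := m) h.inner φ) h.inner φ p =
          -(((m : ℝ) - 2) • jacobi g.inner h.inner
              (fun x => differential (m := m) (n := n) φ x (V x)) p)
          + (2 * (m : ℝ) * lam p ^ 2 *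
              (-laplacian g.inner logLam p - 2 * g.inner p (V p) (V p))) • η p
          + ((m : ℝ) * ((m : ℝ) - 6) * lam p ^ 2) • covDerivAlong h.inner η p (V p) := by
  have hg := isRiemannian_inner g
  have hh := isRiemannian_inner h
  -- The equivalence holds at each point separately: by `key` the bitension at `p` is the difference
  -- of the two sides of the equation there.
  refine forall_congr' fun p => ?_
  have key := bitension_conformal hg hh hφ p
  have hj := jacobi_eq g.inner h.inner φ
    (fun x => differential (m := m) (n := n) φ x (grad g.inner (fun x => Real.log (lam x)) x)) p
  have hiff : fieldAt (bitension g.inner h.inner φ) p = 0 ↔ _ :=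
    (Eq.congr_left key).trans sub_eq_zero
  have hj' : -negJacobi g.inner h.inner φ (fun x => diffAt (m := m) (n := n) φ x
      (gradAt g.inner (fun x => Real.log (lam x)) x)) p = _ := hj.symm
  rw [hj'] at hiff
  exact hiff
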